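/- **Setting.** Let $\mathfrak g$ be the untwisted affinization of a simple complex Lie algebra $\mathfrak g_o$ of simply-laced type and rank $\ell$. Let $\Pi=\{a_1,\dots,a_{\ell+1}\}$ be its simple roots, $a_i^\vee$ the simple coroots, $Q^\vee=\bigoplus_i\mathbb Z a_i^\vee$, $Q^\vee_-=-\sum_i\mathbb Z_{\ge0}a_i^\vee$, $\mathbf c$ the minimal positive imaginary coroot, and $W$ the affine Weyl group, generated by the simple reflections $w_a$, $a\in\Pi$. Let $v$ be a formal variable, and write $\mathcal Q^{fin}_v=\mathbb C[v^{-1}][[Q^\vee_-]]$ for the ring of formal series $\sum_{\gamma\in Q^\vee_-}c_\gamma e^\gamma$ with $c_\gamma\in\mathbb C[v^{-1}]$. It is contained in the ring $\mathcal L$ of formal series $\sum_{\gamma\in Q^\vee}c_\gamma e^{\gamma}$, $c_\gamma\in\mathbb C[v^{-1}]$, with support in a finite union of cones $\gamma_k+Q^\vee_-$. Rational functions in the $e^\gamma$ and $v^{-1}$ are expanded in negative powers of the coroots: $f\in\mathcal L$ is the expansion of $n/d$ if $df=n$. For $w\in W$ and $f\in\mathcal L$ we say that $w f$ is defined and equal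 to $g\in\mathcal L$ if, for some nonzero $d\in\mathbb C[v^{-1}][Q^\vee]$, termwise application of $w$ (that is, $e^\gamma\mapsto e^{w\gamma}$) to $df$ gives $(wd)\,g$. Formal sums $\sum_{u\in W}F_u[u]$, possibly infinite, with $F_u\in\mathcal L$ are multiplied on the left and on the right by elements of the group algebra $R[W]$ over the field $R$ of rational functions, according to $[w]\,r=(wr)\,[w]$. For $a\in\Pi$ put $$\mathbf c(a^\vee)=\frac{1-v^{-1}e^{-a^\vee}}{1-e^{a^\vee}},\qquad \mathbf b(a^\vee)=\frac{v^{-1}-1}{1-e^{a^\vee}},\qquad T_a=\mathbf c(a^\vee)[w_a]+\mathbf b(a^\vee)[1]\in R[W],$$ and $T_w=T_{a_{i_1}}\cdots T_{a_{i_r}}$ for any reduced decomposition $w=w_{a_{i_1}}\cdots w_{a_{i_r}}$. Write $T_w=\sum_u C_u(w)[u]$, with the coefficients expanded in $\mathcal L$, and let $$\mathcal P=\sum_{w\in W}T_w=\sum_{u\in W}C_u\,[u],\qquad C_u=\sum_{w\in W}C_u(w).$$ Finally let $\mathfrak D_v=\prod_{\gamma}(1-v^{-1}e^{-\gamma})^{m(\gamma)}$,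 the product being over all positive coroots $\gamma$, real and imaginary (the latter are the $n\mathbf c$, $n\ge1$), with $m(\gamma)=1$ if $\gamma$ is real and $m(\gamma)=\ell$ if $\gamma$ is imaginary. **Lemma.** The element $\mathcal P$ is well defined: $T_w$ does not depend on the reduced decomposition, its coefficients have expansions in $\mathcal L$, for every $u\in W$ and $\gamma\in Q^\vee$ only finitely many $C_u(w)$ contain $e^\gamma$, and $C_u\in\mathcal Q^{fin}_v$ for every $u$. Moreover $\mathfrak D_v$ is invertible, $\mathfrak D_v^{-1}C_u\in\mathcal Q^{fin}_v$ for all $u$, and for every $a\in\Pi$ all the products below are defined and 1. $T_a\mathcal P=v^{-1}\mathcal P$; 2. $\mathcal P\,T_a=v^{-1}\mathcal P$; 3. $[w_a]\,\mathcal P=\dfrac{1-v^{-1}e^{a^\vee}}{1-v^{-1}e^{-a^\vee}}\;\mathcal P$; 4. $\mathfrak D_v^{-1}\mathcal P$ is $W$-invariant: $[w]\,\mathfrak D_v^{-1}\mathcal P=\mathfrak D_v^{-1}\mathcal P$ for every $w\in W$. -/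

import Mathlib

open Polynomial

noncomputable section

/-!
# Demazure-Lusztig operators and the symmetrizer for simply-laced untwisted affine types

`ℂ[X]` plays the role of `ℂ[v⁻¹]`: the variable `X` is `v⁻¹`.
The coroot lattice `Q^∨` is `I → ℤ`, with the simple coroot `a_i^∨` equal to `Pi.single i 1`.
-/

/-- An indecomposable symmetric generalized Cartan matrix of affine type, with the minimal
imaginary coroot `c`.  Affine type means corank one with a strictly positive null vector; here
`c` is the strictly positive generator of the integral kernel.  The symmetric affine generalized
Cartan matrices are exactly those of the untwisted affinizations of the simple Lie algebras of
simply-laced type (`A_ℓ⁽¹⁾`, `D_ℓ⁽¹⁾`, `E_ℓ⁽¹⁾`), with `|I| = ℓ + 1`.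
The entry `A i j` is `⟨a_j, a_i^∨⟩ = ⟨a_i, a_j^∨⟩`. -/
structure AffineDatum (I : Type*) [Fintype I] [DecidableEq I] where
  A : Matrix I I ℤ
  nonempty : Nonempty I
  symm : A.IsSymm
  diag : ∀ i, A i i = 2
  offDiag : ∀ i j, i ≠ j → A i j ≤ 0
  indecomposable : ∀ s : Set I, s.Nonempty → sᶜ.Nonempty → ∃ i ∈ s, ∃ j ∈ sᶜ, A i j ≠ 0
  c : I → ℤ
  c_pos : ∀ i, 0 < c i
  A_mulVec_c : A.mulVec c = 0
  ker_eq : ∀ x : I → ℤ, A.mulVec x = 0 → ∃ n : ℤ, x = n • c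

/-- The group algebra `ℂ[v⁻¹][Q^∨]`; `e^γ` is `AddMonoidAlgebra.single γ 1`. -/
abbrev CorootAlg (I : Type*) : Type _ := AddMonoidAlgebra ℂ[X] (I → ℤ)

/-- The field of rational functions in the `e^γ` (and `v⁻¹`). -/
abbrev RatFun (I : Type*) : Type _ := FractionRing (CorootAlg I)

/-- Formal series `∑ c_γ e^γ` over `Q^∨` with coefficients in `ℂ[v⁻¹]` whose support lies in a
finite union of cones `{γ ∣ γ ≤ γ_k}` for the dominance order: in the reversed order on
`I → ℤ`, these are exactly the partially well-ordered supports.  The coefficient of `e^γ` in `f`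
is `f.coeff (OrderDual.toDual γ)`. -/
abbrev CorootSeries (I : Type*) : Type _ := HahnSeries (I → ℤ)ᵒᵈ ℂ[X]

/-- The exponential `e^γ` as a formal series. -/
def expS {I : Type*} (γ : I → ℤ) : CorootSeries I := HahnSeries.single (OrderDual.toDual γ) 1

/-- The element `v⁻¹` of the ring of formal series. -/
def vInvS (I : Type*) : CorootSeries I := HahnSeries.C (X : ℂ[X])

/-- The subset `ℂ[v⁻¹][[Q^∨_-]]` of series in the `e^{-γ}`, `γ ∈ Q^∨_+`. -/
def QFin (I : Type*) : Set (CorootSeries I) :=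
  {f | ∀ γ : I → ℤ, f.coeff (OrderDual.toDual γ) ≠ 0 → γ ≤ 0}

/-- The inclusion of `ℂ[v⁻¹][Q^∨]` in the formal series, `e^γ ↦ e^γ`. -/
def toSeries (I : Type*) : CorootAlg I →ₐ[ℂ[X]] CorootSeries I :=
  AddMonoidAlgebra.lift ℂ[X] (CorootSeries I) (I → ℤ)
    { toFun := fun γ => expS γ.toAdd
      map_one' := rfl
      map_mul' := fun γ δ => by
        simp only [expS, HahnSeries.single_mul_single, toAdd_mul, toDual_add, mul_one] }

/-- `f` is the expansion, in negative powers of the coroots, of the rational function `r`: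
if `r = n / d` then `d f = n` as formal series. -/
def IsExpansion {I : Type*} [Fintype I] (r : RatFun I) (f : CorootSeries I) : Prop :=
  ∃ n d : CorootAlg I, d ≠ 0 ∧
    r * algebraMap (CorootAlg I) (RatFun I) d = algebraMap (CorootAlg I) (RatFun I) n ∧
    f * toSeries I d = toSeries I n

/-- The exponential `e^γ` as a rational function. -/
def expR {I : Type*} (γ : I → ℤ) : RatFun I :=
  algebraMap (CorootAlg I) (RatFun I) (AddMonoidAlgebra.single γ 1)

/-- The element `v⁻¹` of the field of rational functions. -/
def vInvR (I : Type*) : RatFun I :=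
  algebraMap (CorootAlg I) (RatFun I) (AddMonoidAlgebra.single 0 X)

/-- `𝐜(γ) = (1 - v⁻¹ e^{-γ}) / (1 - e^γ)`. -/
def cFun {I : Type*} [Fintype I] (γ : I → ℤ) : RatFun I :=
  (1 - vInvR I * expR (-γ)) / (1 - expR γ)

/-- `𝐛(γ) = (v⁻¹ - 1) / (1 - e^γ)`. -/
def bFun {I : Type*} [Fintype I] (γ : I → ℤ) : RatFun I :=
  (vInvR I - 1) / (1 - expR γ)

theorem isPWO_Iic_zero {I : Type*} [Fintype I] : {x : (I → ℤ)ᵒᵈ | OrderDual.ofDual x ≤ 0}.IsPWO := by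
  let φ : (I → ℕ) → (I → ℤ)ᵒᵈ := fun n => OrderDual.toDual (fun i => -(n i : ℤ))
  have hφ : Monotone φ := by
    intro m n hmn
    change (fun i => -(n i : ℤ)) ≤ fun i => -(m i : ℤ)
    intro i
    exact neg_le_neg (Int.ofNat_le.mpr (hmn i))
  refine ((Set.isPWO_of_wellQuasiOrderedLE (Set.univ : Set (I → ℕ))).image_of_monotone hφ).mono ?_
  intro x hx
  refine ⟨fun i => (-(OrderDual.ofDual x i)).toNat, trivial, ?_⟩
  apply OrderDual.ofDual.injective
  funext i
  have : OrderDual.ofDual x i ≤ 0 := hx i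
  change -(((-(OrderDual.ofDual x i)).toNat : ℕ) : ℤ) = OrderDual.ofDual x i
  omega

namespace AffineDatum

variable {I : Type*} [Fintype I] [DecidableEq I] (D : AffineDatum I)

/-- The simple coroot `a_i^∨`. -/
def simpleCoroot (_D : AffineDatum I) (i : I) : I → ℤ := Pi.single i 1

/-- The simple root `a_i` as a linear form on the coroot lattice. -/
def simpleRoot (i : I) : Module.Dual ℤ (I → ℤ) := (LinearMap.proj i).comp D.A.mulVecLin

theorem simpleRoot_simpleCoroot (i : I) : D.simpleRoot i (D.simpleCoroot i) = 2 := by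
  simp [simpleRoot, simpleCoroot, D.diag]

/-- The simple reflection `w_i : x ↦ x - ⟨a_i, x⟩ a_i^∨`. -/
def simpleReflection (i : I) : (I → ℤ) ≃ₗ[ℤ] (I → ℤ) :=
  Module.reflection (D.simpleRoot_simpleCoroot i)

/-- The affine Weyl group, generated by the simple reflections. -/
def weylGroup : Subgroup ((I → ℤ) ≃ₗ[ℤ] (I → ℤ)) :=
  Subgroup.closure (Set.range D.simpleReflection)

/-- The simple reflection `w_i` as an element of the Weyl group. -/
def refl (i : I) : D.weylGroup :=
  ⟨D.simpleReflection i, Subgroup.subset_closure ⟨i, rfl⟩⟩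

/-- The action of `W` on `ℂ[v⁻¹][Q^∨]`, `w e^γ = e^{wγ}`. -/
instance algAction : MulSemiringAction D.weylGroup (CorootAlg I) where
  smul w f := AddMonoidAlgebra.domCongr ℂ[X] ℂ[X] w.1.toAddEquiv f
  one_smul f := by
    change AddMonoidAlgebra.domCongr ℂ[X] ℂ[X] _ f = f
    ext γ
    simp
    rfl
  mul_smul w w' f := by
    change AddMonoidAlgebra.domCongr ℂ[X] ℂ[X] _ f =
      AddMonoidAlgebra.domCongr ℂ[X] ℂ[X] _ (AddMonoidAlgebra.domCongr ℂ[X] ℂ[X] _ f)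
    ext γ
    simp
    rfl
  smul_zero w := map_zero (AddMonoidAlgebra.domCongr ℂ[X] ℂ[X] w.1.toAddEquiv)
  smul_add w := map_add (AddMonoidAlgebra.domCongr ℂ[X] ℂ[X] w.1.toAddEquiv)
  smul_one w := map_one (AddMonoidAlgebra.domCongr ℂ[X] ℂ[X] w.1.toAddEquiv)
  smul_mul w := map_mul (AddMonoidAlgebra.domCongr ℂ[X] ℂ[X] w.1.toAddEquiv)

/-- The induced action of `W` on rational functions. -/
instance ratAction : MulSemiringAction D.weylGroup (RatFun I) :=
  IsFractionRing.mulSemiringAction D.weylGroup (CorootAlg I) (RatFun I)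

/-- The group algebra `R[W]` of `W` over the rational functions, in which
`(r [w]) (s [w']) = r (w s) [w w']`. -/
abbrev RW : Type _ := SkewMonoidAlgebra (RatFun I) D.weylGroup

/-- The element `T_a = 𝐜(a^∨) [w_a] + 𝐛(a^∨) [1]` for `a = a_i`. -/
def T (i : I) : D.RW :=
  SkewMonoidAlgebra.single (D.refl i) (cFun (D.simpleCoroot i)) +
    SkewMonoidAlgebra.single 1 (bFun (D.simpleCoroot i))

/-- The element of `W` spelled by a word in the simple reflections. -/
def wordProd (l : List I) : D.weylGroup := (l.map D.refl).prod

/-- The word `l` is a reduced decomposition. -/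
def IsReduced (l : List I) : Prop :=
  ∀ l' : List I, D.wordProd l' = D.wordProd l → l.length ≤ l'.length

/-- The formal sum `∑_u P_u [u]` is the symmetrizer `∑_w T_w`.  Here `T_w = T_{w_1} ⋯ T_{w_r}`
for every reduced decomposition of `w`, its coefficients are expanded in negative powers of
the coroots as `T_w = ∑_u C_u(w) [u]`, and `P_u = ∑_w C_u(w)`, where every `e^γ` receives
a contribution from only finitely many `w`. -/
def IsSymmetrizer (P : D.weylGroup → CorootSeries I) : Prop :=
  ∃ C : D.weylGroup → D.weylGroup → CorootSeries I,
    (∀ l : List I, D.IsReduced l → ∀ u : D.weylGroup,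
      IsExpansion ((l.map D.T).prod.coeff u) (C u (D.wordProd l))) ∧
    ∀ (u : D.weylGroup) (γ : I → ℤ),
      {w : D.weylGroup | (C u w).coeff (OrderDual.toDual γ) ≠ 0}.Finite ∧
      (P u).coeff (OrderDual.toDual γ) = ∑ᶠ w, (C u w).coeff (OrderDual.toDual γ)

/-- `g` is the series obtained by applying `w` to the series `f` and expanding the result again
in negative powers of the coroots.  Applying `w` termwise to `f` may leave the ring of series,
so a common denominator `d` is cleared first: `w (d f) = (w d) g`, where `w` on the left moves
the coefficient of `e^γ` to `e^{wγ}`.  For the expansion `f` of a rational function `r` this gives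
the expansion of `w r`. -/
def IsTransform (w : D.weylGroup) (f g : CorootSeries I) : Prop :=
  ∃ d : CorootAlg I, d ≠ 0 ∧ ∀ γ : I → ℤ,
    (toSeries I (w • d) * g).coeff (OrderDual.toDual (w.1 γ)) =
      (toSeries I d * f).coeff (OrderDual.toDual γ)

/-- For `t = ∑_y t_y [y]` in `R[W]` and a formal sum `F = ∑_u F_u [u]`, the product
`t F = ∑_u (∑_y t_y · y(F_{y⁻¹u})) [u]` is well defined and equal to `∑_u G_u [u]`. -/
def IsLeftProd (t : D.RW) (F G : D.weylGroup → CorootSeries I) : Prop :=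
  ∃ (E : D.weylGroup → CorootSeries I) (H : D.weylGroup → D.weylGroup → CorootSeries I),
    (∀ y ∈ t.support, IsExpansion (t.coeff y) (E y)) ∧
    (∀ y ∈ t.support, ∀ u, D.IsTransform y (F (y⁻¹ * u)) (H y u)) ∧
    ∀ u, G u = ∑ y ∈ t.support, E y * H y u

/-- For `t = ∑_y t_y [y]` in `R[W]` and a formal sum `F = ∑_u F_u [u]`, the product
`F t = ∑_u (∑_y F_{uy⁻¹} · (uy⁻¹)(t_y)) [u]` is well defined and equal to `∑_u G_u [u]`. -/
def IsRightProd (F : D.weylGroup → CorootSeries I) (t : D.RW)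
    (G : D.weylGroup → CorootSeries I) : Prop :=
  ∃ E : D.weylGroup → D.weylGroup → CorootSeries I,
    (∀ y ∈ t.support, ∀ u, IsExpansion ((u * y⁻¹) • t.coeff y) (E y u)) ∧
    ∀ u, G u = ∑ y ∈ t.support, F (u * y⁻¹) * E y u

/-- The real coroots: the `W`-conjugates of the simple coroots. -/
def IsRealCoroot (γ : I → ℤ) : Prop :=
  ∃ (w : D.weylGroup) (i : I), γ = w.1 (D.simpleCoroot i)

/-- The positive coroots, real and imaginary; the imaginary ones are the positive multiples
of `c`. -/
def IsPosCoroot (γ : I → ℤ) : Prop :=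
  (D.IsRealCoroot γ ∧ 0 ≤ γ) ∨ ∃ n : ℕ, 0 < n ∧ γ = n • D.c

open Classical in
/-- The multiplicity of a coroot: `1` if it is real and `ℓ = |I| - 1` if it is imaginary. -/
def mult (γ : I → ℤ) : ℕ := if D.IsRealCoroot γ then 1 else Fintype.card I - 1

open Classical in
/-- The product of `(1 - v⁻¹ e^{-γ})^{m(γ)}` over the positive coroots `γ` in the finite set
`{0 ≤ γ ≤ β}`. -/
def partialProd (β : I → ℤ) : CorootSeries I :=
  ∏ γ ∈ (Finset.Icc 0 β).filter (fun γ => D.IsPosCoroot γ),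
    (1 - vInvS I * expS (-γ)) ^ D.mult γ

theorem partialProd_coeff_eq_zero {γ : I → ℤ} (h : ¬ γ ≤ 0) :
    (D.partialProd (-γ)).coeff (OrderDual.toDual γ) = 0 := by
  have h1 : Finset.Icc 0 (-γ) = ∅ := by
    rw [Finset.Icc_eq_empty_iff]
    simpa using h
  have h2 : OrderDual.toDual γ ≠ 0 := by
    intro h'
    exact h (le_of_eq h')
  simp [partialProd, h1, HahnSeries.coeff_one, h2]

/-- The infinite product `𝔇_v = ∏_γ (1 - v⁻¹ e^{-γ})^{m(γ)}` over the positive coroots.  The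
coefficient of `e^γ` only involves the factors belonging to positive coroots `≤ -γ`. -/
def Dv : CorootSeries I where
  coeff x := (D.partialProd (-(OrderDual.ofDual x))).coeff x
  isPWO_support' := isPWO_Iic_zero.mono (fun x hx => by
    by_contra h
    exact hx (D.partialProd_coeff_eq_zero (γ := OrderDual.ofDual x) h))

end AffineDatum

end

/-! Convergence. Expanding T_{i_1}⋯T_{i_r} factor by factor writes C_u(w) as a sum over galleries of
type i_1,…,i_r from 1 to u, folded at some walls. If σ is the sum of the coroots of the positive
folds, the exponents of such a term are ≤ -(ρ - uρ) - σ (`exists_expansion_prod_T`). So it must be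
shown that, for given u, a bounded σ allows only finitely many w. The measure is the depth ht(ρ -
wρ). Undoing a positive fold with coroot β changes it by at most ht β times the height of a positive
real coroot made negative by w, and by Cauchy–Schwarz for the semidefinite form such a height is at
most 2√(depth w) (`height_sq_le`). Hence depth w ≤ depth u + 2 ht(σ) √(depth w), which bounds depth
w, and the depth bounds the length (`finite_foldedPath`).

T_w does not depend on the reduced word because of the rank-two relations (`prod_T_eq`). Only A_ij =
0 and A_ij = -1 occur, since two letters generating an infinite group are never descents of the same
element (`neg_one_le_A`).

Eigenvalue equations. Pairing w with w w_a gives sums T_w(1 + T_a), on which right multiplication by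
T_a is multiplication by v⁻¹; summing coefficientwise gives the right equation. On the left, pairing
w with w_a w gives for each pair a rational identity relating the coefficient at u to the w_a-image
of the one at w_a u. The difficulty is that applying w_a termwise to an expansion does not give the
expansion of the image if there is a pole along e^{a^∨} = 1, and one denominator has to serve all w.
The coefficients of T_w have at most simple poles there. For the induction one also carries along
that the residues at u and w_a u are opposite (`HasOppositeResidues.mul_T`). One fixed factor then
suffices (`permuted_symmetrizer`), which gives the transformation under [w_a]; the left equation
follows since 𝐜(a^∨) times the ratio, plus 𝐛(a^∨), is v⁻¹.

Invariance. w_a permutes the positive coroots other than a^∨ and preserves multiplicities, so 𝔇_v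
divided by 1 - v⁻¹e^{-a^∨} is w_a-invariant, and 𝔇_v⁻¹ cancels the ratio acquired by the
symmetrizer. -/

open Polynomial

noncomputable section

namespace AffineDatum

/-! ### Heights, the invariant form and the Weyl group -/

section Height

variable {I : Type*} [Fintype I]

/-- The sum of the coordinates with respect to the simple coroots. -/
def height (I : Type*) [Fintype I] : (I → ℤ) →ₗ[ℤ] ℤ := ∑ i, LinearMap.proj i

theorem height_apply (x : I → ℤ) : height I x = ∑ i, x i := by
  simp [height]

theorem height_nonneg {x : I → ℤ} (h : 0 ≤ x) : 0 ≤ height I x := by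
  rw [height_apply]; exact Finset.sum_nonneg fun i _ => h i

theorem height_mono {x y : I → ℤ} (h : x ≤ y) : height I x ≤ height I y := by
  simp only [height_apply]; exact Finset.sum_le_sum fun i _ => h i

theorem height_pos {x : I → ℤ} (h : 0 ≤ x) (h' : x ≠ 0) : 0 < height I x := by
  rw [height_apply]
  obtain ⟨i, hi⟩ := Function.ne_iff.mp h'
  exact Finset.sum_pos' (fun i _ => h i) ⟨i, Finset.mem_univ i, lt_of_le_of_ne (h i) (Ne.symm hi)⟩

end Height

variable {I : Type*} [Fintype I] [DecidableEq I] (D : AffineDatum I)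

theorem height_simpleCoroot (i : I) : height I (D.simpleCoroot i) = 1 := by
  simp [height_apply, simpleCoroot]

/-- The symmetric bilinear form on the coroot lattice given by the Cartan matrix. -/
def form : LinearMap.BilinForm ℤ (I → ℤ) := Matrix.toBilin' D.A

theorem form_def (x y : I → ℤ) : D.form x y = x ⬝ᵥ D.A.mulVec y :=
  Matrix.toBilin'_apply' _ _ _

theorem form_eq_sum (x y : I → ℤ) : D.form x y = ∑ i, ∑ j, x i * D.A i j * y j :=
  Matrix.toBilin'_apply _ _ _

theorem A_comm (i j : I) : D.A i j = D.A j i := D.symm.apply j i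

theorem form_comm (x y : I → ℤ) : D.form x y = D.form y x := by
  rw [form_eq_sum, form_eq_sum, Finset.sum_comm]
  refine Finset.sum_congr rfl fun i _ => Finset.sum_congr rfl fun j _ => ?_
  rw [D.A_comm j i]; ring

theorem form_simpleCoroot_left (i : I) (x : I → ℤ) :
    D.form (D.simpleCoroot i) x = D.simpleRoot i x := by
  rw [form_def]; simp [simpleCoroot, simpleRoot]

theorem form_simpleCoroot (i j : I) :
    D.form (D.simpleCoroot i) (D.simpleCoroot j) = D.A i j := by
  rw [form, simpleCoroot, simpleCoroot]
  exact Matrix.toBilin'_single _ _ _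

theorem form_simpleCoroot_self (i : I) : D.form (D.simpleCoroot i) (D.simpleCoroot i) = 2 := by
  rw [form_simpleCoroot, D.diag]

theorem simpleReflection_apply (i : I) (x : I → ℤ) :
    D.simpleReflection i x = x - D.form (D.simpleCoroot i) x • D.simpleCoroot i := by
  rw [form_simpleCoroot_left, simpleReflection, Module.reflection_apply]

theorem refl_apply (i : I) (x : I → ℤ) :
    (D.refl i).1 x = x - D.form (D.simpleCoroot i) x • D.simpleCoroot i :=
  D.simpleReflection_apply i x

@[simp]
theorem mul_apply (u w : D.weylGroup) (x : I → ℤ) : (u * w).1 x = u.1 (w.1 x) := rfl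

@[simp]
theorem one_apply (x : I → ℤ) : (1 : D.weylGroup).1 x = x := rfl

@[simp]
theorem inv_apply_apply (w : D.weylGroup) (x : I → ℤ) : w⁻¹.1 (w.1 x) = x := by
  rw [← mul_apply, inv_mul_cancel, one_apply]

@[simp]
theorem apply_inv_apply (w : D.weylGroup) (x : I → ℤ) : w.1 (w⁻¹.1 x) = x := by
  rw [← mul_apply, mul_inv_cancel, one_apply]

@[simp]
theorem refl_simpleCoroot (i : I) : (D.refl i).1 (D.simpleCoroot i) = -D.simpleCoroot i := by
  rw [refl_apply, form_simpleCoroot_self]; module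

@[simp]
theorem refl_mul_self (i : I) : D.refl i * D.refl i = 1 := by
  apply Subtype.ext
  apply LinearEquiv.ext
  intro x
  rw [mul_apply, D.refl_apply i x]
  rw [map_sub, map_smul, refl_simpleCoroot, refl_apply]
  change _ = x
  module

@[simp]
theorem refl_refl_apply (i : I) (x : I → ℤ) : (D.refl i).1 ((D.refl i).1 x) = x := by
  rw [← mul_apply, refl_mul_self, one_apply]

@[simp]
theorem refl_inv (i : I) : (D.refl i)⁻¹ = D.refl i :=
  inv_eq_of_mul_eq_one_right (D.refl_mul_self i)

@[simp]
theorem mul_refl_mul_refl (w : D.weylGroup) (i : I) : w * D.refl i * D.refl i = w := by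
  rw [mul_assoc, refl_mul_self, mul_one]

@[simp]
theorem refl_mul_refl_mul (w : D.weylGroup) (i : I) : D.refl i * (D.refl i * w) = w := by
  rw [← mul_assoc, refl_mul_self, one_mul]

@[simp]
theorem wordProd_nil : D.wordProd [] = 1 := rfl

@[simp]
theorem wordProd_cons (i : I) (l : List I) : D.wordProd (i :: l) = D.refl i * D.wordProd l := by
  simp [wordProd]

@[simp]
theorem wordProd_append (l l' : List I) :
    D.wordProd (l ++ l') = D.wordProd l * D.wordProd l' := by
  simp [wordProd]

@[simp]
theorem wordProd_reverse (l : List I) : D.wordProd l.reverse = (D.wordProd l)⁻¹ := by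
  induction l with
  | nil => simp
  | cons i l ih => simp [ih]

theorem exists_wordProd (w : D.weylGroup) : ∃ l, D.wordProd l = w := by
  obtain ⟨w, hw⟩ := w
  induction hw using Subgroup.closure_induction with
  | mem x hx =>
    obtain ⟨i, rfl⟩ := hx
    exact ⟨[i], by simp [wordProd]; rfl⟩
  | one => exact ⟨[], rfl⟩
  | mul x y hx hy ihx ihy =>
    obtain ⟨l, hl⟩ := ihx
    obtain ⟨l', hl'⟩ := ihy
    exact ⟨l ++ l', by rw [wordProd_append, hl, hl']; rfl⟩
  | inv x hx ih =>
    obtain ⟨l, hl⟩ := ih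
    exact ⟨l.reverse, by rw [wordProd_reverse, hl]; rfl⟩

/-- Induction on elements of the Weyl group, multiplying by simple reflections on the right. -/
theorem weyl_induction {p : D.weylGroup → Prop} (one : p 1)
    (step : ∀ w i, p w → p (w * D.refl i)) (w : D.weylGroup) : p w := by
  obtain ⟨l, rfl⟩ := D.exists_wordProd w
  induction l using List.reverseRecOn with
  | nil => exact one
  | append_singleton l i ih => simpa using step _ i ih

theorem form_refl (i : I) (x y : I → ℤ) :
    D.form ((D.refl i).1 x) ((D.refl i).1 y) = D.form x y := by
  simp only [refl_apply, map_sub, map_smul, LinearMap.sub_apply, LinearMap.smul_apply, smul_eq_mul,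
    form_simpleCoroot_self]
  rw [D.form_comm x (D.simpleCoroot i)]; ring

theorem form_apply (w : D.weylGroup) (x y : I → ℤ) : D.form (w.1 x) (w.1 y) = D.form x y := by
  induction w using D.weyl_induction generalizing x y with
  | one => rfl
  | step w i ih => rw [mul_apply, mul_apply, ih, form_refl]

theorem form_inv_right (w : D.weylGroup) (x y : I → ℤ) :
    D.form x (w.1 y) = D.form (w⁻¹.1 x) y := by
  rw [← D.form_apply w (w⁻¹.1 x), apply_inv_apply]

theorem form_c_right (x : I → ℤ) : D.form x D.c = 0 := by
  rw [form_def, D.A_mulVec_c, dotProduct_zero]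

theorem apply_c (w : D.weylGroup) : w.1 D.c = D.c := by
  induction w using D.weyl_induction with
  | one => rfl
  | step w i ih => rw [mul_apply, refl_apply, form_c_right, zero_smul, sub_zero, ih]

/-- The form is positive semidefinite. -/
theorem form_self_nonneg (x : I → ℤ) : 0 ≤ D.form x x := by
  have hc : ∀ i, (D.c i : ℚ) ≠ 0 := fun i => by exact_mod_cast (D.c_pos i).ne'
  set y : I → ℚ := fun i => x i / D.c i with hy
  have hx : ∀ i, (x i : ℚ) = D.c i * y i := fun i => by
    rw [hy]; field_simp [hc i]
  have h0 : ∀ i, ∑ j, (D.A i j : ℚ) * D.c j = 0 := fun i => by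
    have := congrFun D.A_mulVec_c i
    simp only [Matrix.mulVec, dotProduct, Pi.zero_apply] at this
    exact_mod_cast this
  -- With x = c·y coordinatewise and A c = 0, the terms in y_i² and y_j² sum to zero; what remains
  -- has nonnegative coefficients off the diagonal.
  have h1 : (2 * D.form x x : ℚ) = ∑ i, ∑ j, -(D.A i j : ℚ) * D.c i * D.c j * (y i - y j) ^ 2 := by
    have e1 : ∑ i, ∑ j, (D.A i j : ℚ) * D.c i * D.c j * y i ^ 2 = 0 := by
      refine Finset.sum_eq_zero fun i _ => ?_
      have : ∀ j, (D.A i j : ℚ) * D.c i * D.c j * y i ^ 2 = D.c i * y i ^ 2 * (D.A i j * D.c j) :=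
        fun j => by ring
      rw [Finset.sum_congr rfl fun j _ => this j, ← Finset.mul_sum, h0, mul_zero]
    have e2 : ∑ i, ∑ j, (D.A i j : ℚ) * D.c i * D.c j * y j ^ 2 = 0 := by
      rw [Finset.sum_comm, ← e1]
      refine Finset.sum_congr rfl fun i _ => Finset.sum_congr rfl fun j _ => ?_
      rw [D.A_comm]; ring
    have e3 : (D.form x x : ℚ) = ∑ i, ∑ j, (D.A i j : ℚ) * D.c i * D.c j * (y i * y j) := by
      rw [form_eq_sum]
      push_cast
      refine Finset.sum_congr rfl fun i _ => Finset.sum_congr rfl fun j _ => ?_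
      rw [hx i, hx j]; ring
    have e4 : ∀ i j, -(D.A i j : ℚ) * D.c i * D.c j * (y i - y j) ^ 2 =
        2 * ((D.A i j : ℚ) * D.c i * D.c j * (y i * y j)) -
        ((D.A i j : ℚ) * D.c i * D.c j * y i ^ 2 + (D.A i j : ℚ) * D.c i * D.c j * y j ^ 2) :=
      fun i j => by ring
    simp only [e4, Finset.sum_sub_distrib, Finset.sum_add_distrib, e1, e2, ← Finset.mul_sum, ← e3]
    ring
  have h2 : (0 : ℚ) ≤ 2 * D.form x x := by
    rw [h1]
    refine Finset.sum_nonneg fun i _ => Finset.sum_nonneg fun j _ => ?_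
    by_cases hij : i = j
    · simp [hij]
    · have h3 : (0 : ℚ) ≤ -(D.A i j) := by exact_mod_cast neg_nonneg.mpr (D.offDiag i j hij)
      have h4 : (0 : ℚ) ≤ D.c i := by exact_mod_cast (D.c_pos i).le
      have h5 : (0 : ℚ) ≤ D.c j := by exact_mod_cast (D.c_pos j).le
      positivity
  have : (0 : ℚ) ≤ D.form x x := by linarith
  exact_mod_cast this

theorem form_sq_le (x y : I → ℤ) : D.form x y ^ 2 ≤ D.form x x * D.form y y :=
  LinearMap.BilinForm.apply_sq_le_of_symm D.form D.form_self_nonneg ⟨D.form_comm⟩ x y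

theorem form_right_eq_zero {x : I → ℤ} (h : D.form x x = 0) (y : I → ℤ) : D.form y x = 0 := by
  have := D.form_sq_le y x
  rw [h, mul_zero] at this
  exact pow_eq_zero_iff two_ne_zero |>.mp (le_antisymm this (sq_nonneg _))

theorem eq_smul_c_of_form_self_eq_zero {x : I → ℤ} (h : D.form x x = 0) :
    ∃ n : ℤ, x = n • D.c := by
  apply D.ker_eq
  funext i
  have := D.form_right_eq_zero h (D.simpleCoroot i)
  rw [form_simpleCoroot_left] at this
  simpa [simpleRoot] using this

theorem even_form_self (x : I → ℤ) : Even (D.form x x) := by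
  have key : ∀ s : Finset I, Even (D.form (∑ i ∈ s, x i • D.simpleCoroot i)
      (∑ i ∈ s, x i • D.simpleCoroot i)) := by
    intro s
    induction s using Finset.induction_on with
    | empty => simp
    | insert a s ha ih =>
      rw [Finset.sum_insert ha]
      simp only [map_add, LinearMap.add_apply]
      rw [D.form_comm (∑ i ∈ s, x i • D.simpleCoroot i) (x a • D.simpleCoroot a)]
      obtain ⟨k, hk⟩ := ih
      rw [hk]
      simp only [map_smul, LinearMap.smul_apply, smul_eq_mul, form_simpleCoroot_self]
      refine ⟨x a * x a + (x a * D.form (D.simpleCoroot a) (∑ i ∈ s, x i • D.simpleCoroot i)) + k, ?_⟩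
      ring
  have : x = ∑ i, x i • D.simpleCoroot i := by
    funext j; simp [simpleCoroot, Finset.sum_apply, Pi.single_apply]
  rw [this]; exact key _

/-- A nonzero element of `Q^∨_+` without full support has norm at least `2`. -/
theorem two_le_form_self {x : I → ℤ} (hx : x ≠ 0) {i : I} (hi : x i = 0) :
    2 ≤ D.form x x := by
  -- Isotropic vectors are multiples of `c`, which have full support unless zero. Evenness then
  -- improves positivity to 2.
  have h0 : D.form x x ≠ 0 := by
    intro h
    obtain ⟨n, rfl⟩ := D.eq_smul_c_of_form_self_eq_zero h
    simp only [Pi.smul_apply, smul_eq_mul, mul_eq_zero, (D.c_pos i).ne', or_false] at hi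
    exact hx (by rw [hi, zero_smul])
  have h1 := D.form_self_nonneg x
  obtain ⟨k, hk⟩ := D.even_form_self x
  omega

/-! ### Real coroots and their signs -/

namespace IsRealCoroot

variable {D} {γ : I → ℤ}

theorem form_self (h : D.IsRealCoroot γ) : D.form γ γ = 2 := by
  obtain ⟨w, i, rfl⟩ := h
  rw [form_apply, form_simpleCoroot_self]

theorem simple (i : I) : D.IsRealCoroot (D.simpleCoroot i) := ⟨1, i, rfl⟩

theorem apply (h : D.IsRealCoroot γ) (w : D.weylGroup) : D.IsRealCoroot (w.1 γ) := by
  obtain ⟨u, i, rfl⟩ := h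
  exact ⟨w * u, i, rfl⟩

theorem neg (h : D.IsRealCoroot γ) : D.IsRealCoroot (-γ) := by
  obtain ⟨u, i, rfl⟩ := h
  exact ⟨u * D.refl i, i, by rw [mul_apply, refl_simpleCoroot, map_neg]⟩

theorem ne_zero (h : D.IsRealCoroot γ) : γ ≠ 0 := by
  rintro rfl
  simpa using h.form_self

/-- A real coroot is positive or negative. -/
theorem nonneg_or_nonpos (h : D.IsRealCoroot γ) : 0 ≤ γ ∨ γ ≤ 0 := by
  by_contra hcon
  push Not at hcon
  obtain ⟨h1, h2⟩ := hcon
  obtain ⟨i, hi⟩ : ∃ i, γ i < 0 := by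
    by_contra hc; push Not at hc; exact h1 hc
  obtain ⟨j, hj⟩ : ∃ j, 0 < γ j := by
    by_contra hc; push Not at hc; exact h2 hc
  -- Each part is nonzero and misses a coordinate, so has norm at least 2; disjoint supports make
  -- their pairing ≤ 0. The norm of `γ` would then be at least 4, not 2.
  have hγ : γ = γ⁺ - γ⁻ := (posPart_sub_negPart γ).symm
  have hp : ∀ k, γ⁺ k = max (γ k) 0 := fun k => rfl
  have hn : ∀ k, γ⁻ k = max (-γ k) 0 := fun k => rfl
  have a1 : 2 ≤ D.form γ⁺ γ⁺ := D.two_le_form_self (i := i)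
    (fun h0 => by have := hp j; rw [h0] at this; simp at this; omega)
    (by rw [hp]; omega)
  have a2 : 2 ≤ D.form γ⁻ γ⁻ := D.two_le_form_self (i := j)
    (fun h0 => by have := hn i; rw [h0] at this; simp at this; omega)
    (by rw [hn]; omega)
  have a3 : D.form γ⁺ γ⁻ ≤ 0 := by
    rw [form_eq_sum]
    refine Finset.sum_nonpos fun k _ => Finset.sum_nonpos fun m _ => ?_
    have e1 : 0 ≤ γ⁺ k := by rw [hp]; omega
    have e2 : 0 ≤ γ⁻ m := by rw [hn]; omega
    by_cases hkm : k = m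
    · subst hkm
      have : γ⁺ k = 0 ∨ γ⁻ k = 0 := by rw [hp, hn]; omega
      rcases this with h | h <;> simp [h]
    · exact mul_nonpos_of_nonpos_of_nonneg
        (mul_nonpos_of_nonneg_of_nonpos e1 (D.offDiag k m hkm)) e2
  have a4 := h.form_self
  rw [hγ] at a4
  simp only [map_sub, LinearMap.sub_apply] at a4
  rw [D.form_comm γ⁻ γ⁺] at a4
  omega

theorem not_nonneg_iff (h : D.IsRealCoroot γ) : ¬ 0 ≤ γ ↔ γ ≤ 0 := by
  refine ⟨fun h' => h.nonneg_or_nonpos.resolve_left h', fun h1 h2 => h.ne_zero (le_antisymm h1 h2)⟩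

theorem one_le_height (h : D.IsRealCoroot γ) (h' : 0 ≤ γ) : 1 ≤ height I γ :=
  height_pos h' h.ne_zero

/-- A simple reflection permutes the positive real coroots other than the simple one. -/
theorem refl_nonneg (h : D.IsRealCoroot γ) (h0 : 0 ≤ γ) {i : I} (hi : γ ≠ D.simpleCoroot i) :
    0 ≤ (D.refl i).1 γ := by
  by_contra hcon
  rw [(h.apply _).not_nonneg_iff] at hcon
  -- The reflection alters only the i-th coordinate, so a change of sign forces `γ` to be a multiple
  -- of a_i^∨, and norm 2 leaves only a_i^∨ itself.
  have h1 : ∀ j, j ≠ i → γ j = 0 := by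
    intro j hj
    have h2 := hcon j
    rw [refl_apply] at h2
    simp only [simpleCoroot, Pi.sub_apply, Pi.smul_apply, Pi.single_apply, if_neg hj,
      smul_zero, sub_zero, Pi.zero_apply] at h2
    exact le_antisymm h2 (h0 j)
  have h2 : γ = γ i • D.simpleCoroot i := by
    funext j
    by_cases hj : j = i
    · subst hj; simp [simpleCoroot]
    · simp [simpleCoroot, hj, h1 j hj]
  have h3 := h.form_self
  rw [h2] at h3
  simp only [map_smul, LinearMap.smul_apply, smul_eq_mul, form_simpleCoroot_self] at h3
  have h4 : γ i * γ i = 1 := by linarith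
  have h5 := h0 i
  simp only [Pi.zero_apply] at h5
  have h6 : γ i = 1 := by nlinarith
  exact hi (by rw [h2, h6, one_smul])

end IsRealCoroot

/-! ### Deletion and reduced words -/

theorem simpleCoroot_nonneg (i : I) : 0 ≤ D.simpleCoroot i := by
  intro j
  simp only [simpleCoroot, Pi.zero_apply, Pi.single_apply]
  split_ifs <;> norm_num

/-- Conjugating w_i by `u` gives the reflection in u a_i^∨, which is insensitive to the sign of that
coroot. -/
theorem mul_refl_eq_refl_mul {u : D.weylGroup} {i j : I}
    (h : u.1 (D.simpleCoroot i) = D.simpleCoroot j ∨ u.1 (D.simpleCoroot i) = -D.simpleCoroot j) :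
    u * D.refl i = D.refl j * u := by
  apply Subtype.ext
  apply LinearEquiv.ext
  intro x
  rw [mul_apply, mul_apply, D.refl_apply i, D.refl_apply j, map_sub, map_smul,
    ← D.form_apply u (D.simpleCoroot i)]
  rcases h with h | h
  · rw [h]
  · rw [h]; simp

/-- The deletion property. -/
theorem exists_delete {l : List I} {i : I} (h : (D.wordProd l).1 (D.simpleCoroot i) ≤ 0) :
    ∃ l' : List I, l'.length + 1 = l.length ∧ D.wordProd l' = D.wordProd l * D.refl i := by
  induction l with
  | nil =>
    exact absurd (le_antisymm h (D.simpleCoroot_nonneg i)) (IsRealCoroot.simple (D := D) i).ne_zero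
  | cons j l ih =>
    have hr := (IsRealCoroot.simple (D := D) i).apply (D.wordProd l)
    rcases hr.nonneg_or_nonpos with h1 | h1
    · have h2 : (D.wordProd l).1 (D.simpleCoroot i) = D.simpleCoroot j := by
        by_contra hne
        have h3 := hr.refl_nonneg h1 hne
        rw [wordProd_cons, mul_apply] at h
        exact (hr.apply (D.refl j)).ne_zero (le_antisymm h h3)
      refine ⟨l, rfl, ?_⟩
      rw [wordProd_cons, mul_assoc, D.mul_refl_eq_refl_mul (Or.inl h2), refl_mul_refl_mul]
    · obtain ⟨l', h2, h3⟩ := ih h1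
      exact ⟨j :: l', by simp [h2], by rw [wordProd_cons, wordProd_cons, h3, mul_assoc]⟩

theorem exists_reduced (w : D.weylGroup) : ∃ l, D.IsReduced l ∧ D.wordProd l = w := by
  classical
  have h : ∃ n, ∃ l, D.wordProd l = w ∧ l.length = n := by
    obtain ⟨l, hl⟩ := D.exists_wordProd w
    exact ⟨_, l, hl, rfl⟩
  obtain ⟨l, hl, hn⟩ := Nat.find_spec h
  exact ⟨l, fun l' h' => hn ▸ Nat.find_min' h ⟨l', h'.trans hl, rfl⟩, hl⟩

variable {D}

theorem IsReduced.reverse {l : List I} (h : D.IsReduced l) : D.IsReduced l.reverse := by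
  intro l' hl'
  have := h l'.reverse (by rw [wordProd_reverse, hl', wordProd_reverse, inv_inv])
  simpa using this

theorem IsReduced.left {l l' : List I} (h : D.IsReduced (l ++ l')) : D.IsReduced l := by
  intro m hm
  have := h (m ++ l') (by rw [wordProd_append, wordProd_append, hm])
  simpa using this

theorem IsReduced.right {l l' : List I} (h : D.IsReduced (l ++ l')) : D.IsReduced l' := by
  intro m hm
  have := h (l ++ m) (by rw [wordProd_append, wordProd_append, hm])
  simpa using this

theorem IsReduced.apply_nonneg {l : List I} {i : I} (h : D.IsReduced (l ++ [i])) :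
    0 ≤ (D.wordProd l).1 (D.simpleCoroot i) := by
  by_contra hcon
  rw [((IsRealCoroot.simple i).apply _).not_nonneg_iff] at hcon
  obtain ⟨l', h1, h2⟩ := D.exists_delete hcon
  have := h l' (by simp [h2])
  simp at this
  omega

theorem IsReduced.append {l : List I} {i : I} (h : D.IsReduced l)
    (hi : 0 ≤ (D.wordProd l).1 (D.simpleCoroot i)) : D.IsReduced (l ++ [i]) := by
  intro l' hl'
  by_contra hcon
  obtain ⟨m, h1, h2⟩ := D.exists_delete (l := l') (i := i) (by
    rw [hl']; simpa using hi)
  have := h m (by rw [h2, hl']; simp)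
  simp at hcon
  omega

theorem IsReduced.apply_inv_nonneg {l : List I} {i : I} (h : D.IsReduced (i :: l)) :
    0 ≤ (D.wordProd l)⁻¹.1 (D.simpleCoroot i) := by
  have h1 := h.reverse
  rw [List.reverse_cons] at h1
  simpa using h1.apply_nonneg

theorem IsReduced.cons {l : List I} {i : I} (h : D.IsReduced l)
    (hi : 0 ≤ (D.wordProd l)⁻¹.1 (D.simpleCoroot i)) : D.IsReduced (i :: l) := by
  have := (h.reverse.append (i := i) (by simpa using hi)).reverse
  simpa using this

variable (D)

theorem exists_reduced_cons {w : D.weylGroup} {i : I} (h : w⁻¹.1 (D.simpleCoroot i) ≤ 0) :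
    ∃ l, D.IsReduced (i :: l) ∧ D.wordProd l = D.refl i * w := by
  obtain ⟨l, hl, hw⟩ := D.exists_reduced (D.refl i * w)
  refine ⟨l, hl.cons ?_, hw⟩
  rw [hw]; simpa using h

end AffineDatum

/-! ### Inversions and depth -/

namespace AffineDatum

variable {I : Type*} [Fintype I] [DecidableEq I] (D : AffineDatum I)

/-- The positive real coroots made negative by `w⁻¹`. -/
def inversions (w : D.weylGroup) : Set (I → ℤ) :=
  {β | D.IsRealCoroot β ∧ 0 ≤ β ∧ w⁻¹.1 β ≤ 0}

theorem simple_ne_nonpos (i : I) : ¬ D.simpleCoroot i ≤ 0 := fun h =>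
  (IsRealCoroot.simple (D := D) i).ne_zero (le_antisymm h (D.simpleCoroot_nonneg i))

theorem inversions_one : D.inversions 1 = ∅ := by
  ext β
  simp only [inversions, inv_one, one_apply, Set.mem_ofPred_eq, Set.mem_empty_iff_false, iff_false]
  rintro ⟨h, h1, h2⟩
  exact h.ne_zero (le_antisymm h2 h1)

theorem inversions_mul_refl {w : D.weylGroup} {i : I} (h : 0 ≤ w.1 (D.simpleCoroot i)) :
    D.inversions (w * D.refl i) = insert (w.1 (D.simpleCoroot i)) (D.inversions w) := by
  have hs := IsRealCoroot.simple (D := D) i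
  ext β
  simp only [inversions, mul_inv_rev, refl_inv, mul_apply, Set.mem_ofPred_eq, Set.mem_insert_iff]
  constructor
  · rintro ⟨h1, h2, h3⟩
    have hd := h1.apply w⁻¹
    rcases hd.nonneg_or_nonpos with h4 | h4
    · left
      by_contra hne
      have h5 := hd.refl_nonneg h4 (i := i) (fun h6 => hne (by rw [← h6, apply_inv_apply]))
      exact (hd.apply (D.refl i)).ne_zero (le_antisymm h3 h5)
    · exact Or.inr ⟨h1, h2, h4⟩
  · rintro (rfl | ⟨h1, h2, h3⟩)
    · refine ⟨hs.apply w, h, ?_⟩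
      rw [inv_apply_apply, refl_simpleCoroot]
      simpa using D.simpleCoroot_nonneg i
    · refine ⟨h1, h2, ?_⟩
      have hd := (h1.apply w⁻¹).neg
      have h5 := hd.refl_nonneg (by simpa using h3) (i := i) (fun h6 => by
        have : β = -w.1 (D.simpleCoroot i) := by
          rw [← h6, map_neg, apply_inv_apply, neg_neg]
        refine h1.ne_zero (le_antisymm ?_ h2)
        rw [this]; simpa using h)
      rw [map_neg] at h5
      simpa using h5

theorem apply_simple_notMem_inversions (w : D.weylGroup) (i : I) :
    w.1 (D.simpleCoroot i) ∉ D.inversions w := by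
  rintro ⟨-, -, h⟩
  rw [inv_apply_apply] at h
  exact D.simple_ne_nonpos i h

theorem inversions_finite (w : D.weylGroup) : (D.inversions w).Finite := by
  induction w using D.weyl_induction with
  | one => rw [inversions_one]; exact Set.finite_empty
  | step w i ih =>
    rcases ((IsRealCoroot.simple (D := D) i).apply w).nonneg_or_nonpos with h | h
    · rw [inversions_mul_refl D h]; exact ih.insert _
    · refine ih.subset ?_
      have := D.inversions_mul_refl (w := w * D.refl i) (i := i) (by simpa using h)
      rw [mul_refl_mul_refl] at this
      rw [this]; exact Set.subset_insert _ _

/-- The sum of the inversions of `w⁻¹`, i.e. `ρ - wρ`. -/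
def invSum (w : D.weylGroup) : I → ℤ := ∑ᶠ β ∈ D.inversions w, β

theorem invSum_one : D.invSum 1 = 0 := by
  rw [invSum, inversions_one]; simp

theorem invSum_nonneg (w : D.weylGroup) : 0 ≤ D.invSum w := by
  refine finsum_mem_induction (p := fun x => 0 ≤ x) le_rfl (fun _ _ => add_nonneg) ?_
  exact fun β hβ => hβ.2.1

theorem invSum_mul_refl (w : D.weylGroup) (i : I) :
    D.invSum (w * D.refl i) = D.invSum w + w.1 (D.simpleCoroot i) := by
  have key : ∀ w : D.weylGroup, 0 ≤ w.1 (D.simpleCoroot i) →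
      D.invSum (w * D.refl i) = D.invSum w + w.1 (D.simpleCoroot i) := by
    intro w h
    rw [invSum, inversions_mul_refl D h, finsum_mem_insert _ (D.apply_simple_notMem_inversions w i)
      (D.inversions_finite w), add_comm]
    rfl
  rcases ((IsRealCoroot.simple (D := D) i).apply w).nonneg_or_nonpos with h | h
  · exact key w h
  · have := key (w * D.refl i) (by simpa using h)
    rw [mul_refl_mul_refl, mul_apply, refl_simpleCoroot, map_neg] at this
    rw [this]; abel

/-- The cocycle identity of w ↦ ρ - wρ, obtained without introducing ρ. -/
theorem invSum_mul (u w : D.weylGroup) : D.invSum (u * w) = D.invSum u + u.1 (D.invSum w) := by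
  induction w using D.weyl_induction with
  | one => simp [invSum_one]
  | step w i ih => rw [← mul_assoc, invSum_mul_refl, ih, invSum_mul_refl, map_add, mul_apply]; abel

theorem invSum_refl (i : I) : D.invSum (D.refl i) = D.simpleCoroot i := by
  have := D.invSum_mul_refl 1 i
  simpa [invSum_one] using this

/-- Formally (x, ρ) = ht x, and invariance of the form turns (x, wρ) into ht(w⁻¹x). -/
theorem form_invSum (w : D.weylGroup) (x : I → ℤ) :
    D.form x (D.invSum w) = height I x - height I (w⁻¹.1 x) := by
  induction w using D.weyl_induction with
  | one => simp [invSum_one]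
  | step w i ih =>
    rw [invSum_mul_refl, map_add, ih, mul_inv_rev, refl_inv, mul_apply, refl_apply, map_sub,
      map_smul, D.height_simpleCoroot, form_inv_right, D.form_comm (D.simpleCoroot i)]
    simp only [smul_eq_mul, mul_one]; ring

/-- The height of `ρ - wρ`. -/
def depth (w : D.weylGroup) : ℤ := height I (D.invSum w)

theorem depth_nonneg (w : D.weylGroup) : 0 ≤ D.depth w := height_nonneg (D.invSum_nonneg w)

/-- By the cocycle identity the two sums differ by (1 - (a_i^∨, ρ - wρ)) u a_i^∨, and that pairing
is 1 - ht(w⁻¹a_i^∨). This measures the effect on the depth of inserting or removing one wall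
crossing. -/
theorem depth_mul_refl_mul (u w : D.weylGroup) (i : I) :
    D.depth (u * (D.refl i * w)) = D.depth (u * w) +
      height I (u.1 (D.simpleCoroot i)) * height I (w⁻¹.1 (D.simpleCoroot i)) := by
  have h1 : D.invSum (u * (D.refl i * w)) = D.invSum (u * w) +
      height I (w⁻¹.1 (D.simpleCoroot i)) • u.1 (D.simpleCoroot i) := by
    rw [invSum_mul, invSum_mul, invSum_refl, invSum_mul, refl_apply, form_invSum,
      D.height_simpleCoroot, map_add, map_sub, map_smul]
    module
  rw [depth, h1, map_add, map_smul, smul_eq_mul, depth]; ring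

theorem depth_mul_refl (u : D.weylGroup) (i : I) :
    D.depth (u * D.refl i) = D.depth u + height I (u.1 (D.simpleCoroot i)) := by
  have := D.depth_mul_refl_mul u 1 i
  simpa [D.height_simpleCoroot] using this

theorem depth_inv (w : D.weylGroup) : D.depth w⁻¹ = D.depth w := by
  induction w using D.weyl_induction with
  | one => simp
  | step w i ih =>
    have := D.depth_mul_refl_mul 1 w⁻¹ i
    simp only [one_mul, one_apply, D.height_simpleCoroot, inv_inv] at this
    rw [mul_inv_rev, refl_inv, this, ih, depth_mul_refl]

/-- Heights of roots made negative by `w` are bounded by the square root of the depth. -/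
theorem height_sq_le {w : D.weylGroup} {γ : I → ℤ} (hγ : D.IsRealCoroot γ) (h0 : 0 ≤ γ)
    (hw : w.1 γ ≤ 0) : height I γ ^ 2 ≤ 4 * D.depth w := by
  -- Cauchy–Schwarz is applied to `γ` and δ = ρ - w⁻¹ρ. Here wδ = -(ρ - wρ) gives δ the norm 2 depth
  -- w, while (γ, δ) = ht γ - ht(wγ) ≥ ht γ.
  have h1 : D.form (D.invSum w⁻¹) (D.invSum w⁻¹) = 2 * D.depth w := by
    rw [form_invSum, inv_inv]
    have h2 := D.invSum_mul w w⁻¹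
    rw [mul_inv_cancel, invSum_one] at h2
    rw [show w.1 (D.invSum w⁻¹) = -D.invSum w by rw [eq_comm, neg_eq_iff_add_eq_zero, ← h2],
      map_neg]
    change D.depth w⁻¹ - -D.depth w = _
    rw [depth_inv]; ring
  have h2 := D.form_sq_le γ (D.invSum w⁻¹)
  rw [h1, hγ.form_self, form_invSum, inv_inv] at h2
  have h3 : height I (w.1 γ) ≤ 0 := by simpa using height_mono hw
  have h4 := height_nonneg h0
  nlinarith

/-- Every letter of a reduced word adds the height of a positive coroot, hence at least 1. -/
theorem length_le_depth {l : List I} (h : D.IsReduced l) : (l.length : ℤ) ≤ D.depth (D.wordProd l) := by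
  induction l using List.reverseRecOn with
  | nil => simp [depth, invSum_one]
  | append_singleton l i ih =>
    have h1 := ((IsRealCoroot.simple (D := D) i).apply (D.wordProd l)).one_le_height h.apply_nonneg
    have h2 := ih h.left
    simp only [wordProd_append, wordProd_cons, wordProd_nil, mul_one, depth_mul_refl,
      List.length_append, List.length_singleton]
    push_cast; linarith

theorem finite_depth_le (n : ℕ) : {w : D.weylGroup | D.depth w ≤ n}.Finite := by
  refine ((List.finite_length_le I n).image D.wordProd).subset ?_
  intro w hw
  obtain ⟨l, hl, rfl⟩ := D.exists_reduced w
  have := D.length_le_depth hl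
  simp only [Set.mem_ofPred_eq] at hw
  exact ⟨l, by simp only [Set.mem_ofPred_eq]; omega, rfl⟩

/-! ### Folded galleries -/

/-- `FoldedPath l u σ`: a gallery of type `l` from `1` to `u`, folded at some of its walls; `σ` is
the sum of the roots of the walls at which it is folded back to the side of `1`. -/
inductive FoldedPath : List I → D.weylGroup → (I → ℤ) → Prop
  | nil : FoldedPath [] 1 0
  | cross {l u σ} (i : I) : FoldedPath l u σ → FoldedPath (l ++ [i]) (u * D.refl i) σ
  | foldPos {l u σ} (i : I) : 0 ≤ u.1 (D.simpleCoroot i) → FoldedPath l u σ →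
      FoldedPath (l ++ [i]) u (σ + u.1 (D.simpleCoroot i))
  | foldNeg {l u σ} (i : I) : u.1 (D.simpleCoroot i) ≤ 0 → FoldedPath l u σ →
      FoldedPath (l ++ [i]) u σ

variable {D}

theorem FoldedPath.nonneg {l : List I} {u : D.weylGroup} {σ : I → ℤ} (h : D.FoldedPath l u σ) :
    0 ≤ σ := by
  induction h with
  | nil => exact le_rfl
  | cross i h ih => exact ih
  | foldPos i hi h ih => exact add_nonneg ih hi
  | foldNeg i hi h ih => exact ih

/-- Unfolding a path whose type is the beginning of a reduced word. -/
theorem FoldedPath.depth_le {l : List I} {u : D.weylGroup} {σ : I → ℤ} (h : D.FoldedPath l u σ)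
    (m : List I) (hm : D.IsReduced (l ++ m)) {M : ℤ}
    (hM : ∀ γ, D.IsRealCoroot γ → 0 ≤ γ → (D.wordProd (l ++ m)).1 γ ≤ 0 → height I γ ≤ M) :
    D.depth (D.wordProd (l ++ m)) ≤ D.depth (u * D.wordProd m) + height I σ * M := by
  induction h generalizing m with
  | nil => simp
  | @cross l u σ i h ih =>
    rw [List.append_assoc] at hm hM ⊢
    have := ih ([i] ++ m) hm hM
    rw [wordProd_append D [i] m] at this
    simpa [mul_assoc] using this
  | @foldPos l u σ i hi h ih =>
    rw [List.append_assoc] at hm hM ⊢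
    have h1 := ih ([i] ++ m) hm hM
    -- Undoing the fold replaces u·m by u·w_i·m, at a cost of ht(u a_i^∨) ht(m⁻¹a_i^∨). The second
    -- coroot is positive and is made negative by the whole word, so its height is at most `M`.
    have h2 := hm.right.apply_inv_nonneg
    have hr := (IsRealCoroot.simple (D := D) i).apply (D.wordProd m)⁻¹
    have h3 := hM _ hr h2 (by
      have h4 : D.IsReduced (l ++ [i]) := by
        rw [← List.append_assoc] at hm; exact hm.left
      simpa using h4.apply_nonneg)
    rw [wordProd_append D [i] m] at h1
    simp only [wordProd_cons, wordProd_nil, mul_one, depth_mul_refl_mul] at h1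
    rw [map_add, add_mul]
    have h5 := height_nonneg hi
    nlinarith
  | @foldNeg l u σ i hi h ih =>
    rw [List.append_assoc] at hm hM ⊢
    have h1 := ih ([i] ++ m) hm hM
    have h2 : 0 ≤ height I ((D.wordProd m)⁻¹.1 (D.simpleCoroot i)) :=
      height_nonneg hm.right.apply_inv_nonneg
    rw [wordProd_append D [i] m] at h1
    simp only [wordProd_cons, wordProd_nil, mul_one, depth_mul_refl_mul] at h1
    -- At a negative fold the two heights have opposite signs, so unfolding does not increase the
    -- depth.
    have h5 : height I (u.1 (D.simpleCoroot i)) ≤ 0 := by simpa using height_mono hi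
    nlinarith

variable (D)

/-- Unfolding with M = ⌊√(4K)⌋ gives K ≤ depth u + N·M, which is at most of order √K on the right
and therefore bounds K. -/
theorem FoldedPath.depth_le_of_height_le {l : List I} {u : D.weylGroup} {σ : I → ℤ}
    (h : D.FoldedPath l u σ) (hl : D.IsReduced l) {N : ℤ} (hN : height I σ ≤ N) :
    D.depth (D.wordProd l) ≤ D.depth u + N * (4 * N + 4 * D.depth u + 1) := by
  set K := D.depth (D.wordProd l) with hK
  have hK0 : 0 ≤ K := D.depth_nonneg _
  have hu : 0 ≤ D.depth u := D.depth_nonneg _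
  have hσ : 0 ≤ height I σ := height_nonneg h.nonneg
  have hN0 : 0 ≤ N := hσ.trans hN
  set M : ℤ := Int.sqrt (4 * K) with hMdef
  have hM0 : 0 ≤ M := Int.sqrt_nonneg _
  have hM1 : M * M ≤ 4 * K := by
    have h1 := Nat.sqrt_le (4 * K).toNat
    have h2 : ((4 * K).toNat : ℤ) = 4 * K := Int.toNat_of_nonneg (by linarith)
    rw [hMdef, Int.sqrt, ← h2]
    exact_mod_cast h1
  have hM2 : ∀ x : ℤ, 0 ≤ x → x ^ 2 ≤ 4 * K → x ≤ M := by
    intro x hx hx2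
    have h2 : ((4 * K).toNat : ℤ) = 4 * K := Int.toNat_of_nonneg (by linarith)
    obtain ⟨n, rfl⟩ := Int.eq_ofNat_of_zero_le hx
    rw [hMdef, Int.sqrt]
    have : n ≤ Nat.sqrt (4 * K).toNat := by
      rw [Nat.le_sqrt]
      rw [← h2, pow_two] at hx2
      exact_mod_cast hx2
    exact_mod_cast this
  have h1 := h.depth_le [] (by simpa using hl) (M := M) (by
    intro γ hγ h0 hw
    rw [List.append_nil] at hw
    exact hM2 _ (height_nonneg h0) (D.height_sq_le hγ h0 hw))
  rw [List.append_nil, wordProd_nil, mul_one, ← hK] at h1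
  have h2 : K ≤ D.depth u + N * M := h1.trans (by nlinarith)
  -- From M² ≤ 4K ≤ 4 depth u + 4NM: a larger M would give M² > 4NM + 4M depth u + M.
  have h3 : M ≤ 4 * N + 4 * D.depth u + 1 := by
    by_contra hcon
    push Not at hcon
    nlinarith
  nlinarith

/-- Only finitely many reduced words admit folded paths ending at `u` with small foldings. -/
theorem finite_foldedPath (u : D.weylGroup) (β : I → ℤ) :
    {w : D.weylGroup | ∃ l σ, D.IsReduced l ∧ D.wordProd l = w ∧ D.FoldedPath l u σ ∧
      σ ≤ β}.Finite := by
  set N := height I β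
  refine (D.finite_depth_le (D.depth u + N * (4 * N + 4 * D.depth u + 1)).toNat).subset ?_
  rintro w ⟨l, σ, hl, rfl, hp, hσ⟩
  have := hp.depth_le_of_height_le D hl (height_mono hσ)
  exact this.trans (Int.self_le_toNat _)

end AffineDatum

/-! ### Formal series with support in cones -/

section Series

variable {I : Type*}

/-- All exponents of the series `f` are `≤ μ`. -/
def SupportedBelow (μ : I → ℤ) (f : CorootSeries I) : Prop :=
  ∀ γ : I → ℤ, f.coeff (OrderDual.toDual γ) ≠ 0 → γ ≤ μ

theorem exists_coeff_ne_zero_of_mul {f g : CorootSeries I} {γ : I → ℤ}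
    (h : (f * g).coeff (OrderDual.toDual γ) ≠ 0) :
    ∃ α β, f.coeff (OrderDual.toDual α) ≠ 0 ∧ g.coeff (OrderDual.toDual β) ≠ 0 ∧ α + β = γ := by
  obtain ⟨a, ha, b, hb, hab⟩ := Set.mem_add.mp (HahnSeries.support_mul_subset (x := f) (y := g) h)
  exact ⟨OrderDual.ofDual a, OrderDual.ofDual b, ha, hb, hab⟩

namespace SupportedBelow

variable {μ ν : I → ℤ} {f g : CorootSeries I}

theorem mono (h : SupportedBelow μ f) (hμ : μ ≤ ν) : SupportedBelow ν f :=
  fun γ hγ => (h γ hγ).trans hμ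

theorem add (hf : SupportedBelow μ f) (hg : SupportedBelow μ g) : SupportedBelow μ (f + g) := by
  intro γ h
  by_contra hcon
  have h1 : f.coeff (OrderDual.toDual γ) = 0 := by_contra fun h1 => hcon (hf γ h1)
  have h2 : g.coeff (OrderDual.toDual γ) = 0 := by_contra fun h1 => hcon (hg γ h1)
  exact h (by rw [HahnSeries.coeff_add, h1, h2, add_zero])

theorem neg (hf : SupportedBelow μ f) : SupportedBelow μ (-f) := by
  intro γ h
  exact hf γ (by simpa using h)

theorem sub (hf : SupportedBelow μ f) (hg : SupportedBelow μ g) : SupportedBelow μ (f - g) := by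
  rw [sub_eq_add_neg]; exact hf.add hg.neg

theorem mul (hf : SupportedBelow μ f) (hg : SupportedBelow ν g) :
    SupportedBelow (μ + ν) (f * g) := by
  intro γ h
  obtain ⟨α, β, hα, hβ, rfl⟩ := exists_coeff_ne_zero_of_mul h
  exact add_le_add (hf α hα) (hg β hβ)

theorem single (γ : I → ℤ) (r : ℂ[X]) :
    SupportedBelow γ (HahnSeries.single (OrderDual.toDual γ) r) := by
  intro δ h
  have := HahnSeries.support_single_subset h
  exact (OrderDual.toDual.injective this).le

theorem expS (γ : I → ℤ) : SupportedBelow γ (expS γ) := single γ 1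

theorem vInvS : SupportedBelow 0 (vInvS I) := single 0 _

theorem one : SupportedBelow 0 (1 : CorootSeries I) := single 0 1

end SupportedBelow

@[simp]
theorem expS_zero : expS (0 : I → ℤ) = 1 := rfl

theorem expS_mul_expS (γ δ : I → ℤ) : expS γ * expS δ = expS (γ + δ) := by
  simp [expS, HahnSeries.single_mul_single]

theorem expS_mul_expS_neg (γ : I → ℤ) : expS γ * expS (-γ) = 1 := by
  rw [expS_mul_expS, add_neg_cancel, expS_zero]

/-- The support is partially well-ordered for the reversed order, so each of its coordinate
projections is bounded above. A single cone therefore suffices. -/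
theorem exists_supportedBelow (f : CorootSeries I) : ∃ μ, SupportedBelow μ f := by
  have h : ∀ i, ∃ m : ℤ, ∀ γ : I → ℤ, f.coeff (OrderDual.toDual γ) ≠ 0 → γ i ≤ m := by
    intro i
    by_cases hne : f.support.Nonempty
    · have h1 : ((fun x : (I → ℤ)ᵒᵈ => OrderDual.toDual (OrderDual.ofDual x i)) '' f.support).IsPWO :=
        f.isPWO_support.image_of_monotone (fun x y hxy => hxy i)
      have h2 := h1.isWF
      refine ⟨OrderDual.ofDual (h2.min (hne.image _)), fun γ hγ => ?_⟩
      have h3 := h2.min_le (hne.image _) (Set.mem_image_of_mem _ (show OrderDual.toDual γ ∈ f.support from hγ))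
      exact h3
    · rw [Set.not_nonempty_iff_eq_empty] at hne
      refine ⟨0, fun γ hγ => ?_⟩
      have : OrderDual.toDual γ ∈ f.support := hγ
      rw [hne] at this
      exact absurd this (Set.notMem_empty _)
  choose m hm using h
  exact ⟨m, fun γ hγ i => hm i γ hγ⟩

variable [Fintype I]

/-- Power series in the `e^{-a_i}` as a subring of the ring of formal series. -/
def powerSeriesHom (I : Type*) [Fintype I] : MvPowerSeries I ℂ[X] →+* CorootSeries I :=
  (HahnSeries.embDomainRingHom
    (Γ := I →₀ ℕ) (Γ' := (I → ℤ)ᵒᵈ)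
    { toFun := fun n => OrderDual.toDual (fun i => -(n i : ℤ))
      map_zero' := by
        apply OrderDual.ofDual.injective
        funext i; simp
      map_add' := fun m n => by
        apply OrderDual.ofDual.injective
        funext i; simp; ring }
    (fun m n h => by
      ext i
      have := congrFun (OrderDual.toDual.injective h) i
      simpa using this)
    (fun m n => by
      change (fun i => -(n i : ℤ)) ≤ (fun i => -(m i : ℤ)) ↔ m ≤ n
      rw [Pi.le_def, Finsupp.le_def]
      simp)).comp
    (HahnSeries.toMvPowerSeries (σ := I) (R := ℂ[X])).symm.toRingHom

theorem coeff_powerSeriesHom (p : MvPowerSeries I ℂ[X]) (n : I →₀ ℕ) :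
    (powerSeriesHom I p).coeff (OrderDual.toDual (fun i => -(n i : ℤ))) =
      MvPowerSeries.coeff n p :=
  HahnSeries.embDomain_coeff

theorem powerSeriesHom_supportedBelow (p : MvPowerSeries I ℂ[X]) :
    SupportedBelow 0 (powerSeriesHom I p) := by
  intro γ h
  obtain ⟨n, -, hn⟩ := HahnSeries.support_embDomain_subset h
  have : (fun i => -(n i : ℤ)) = γ := OrderDual.toDual.injective hn
  rw [← this]
  intro i
  simp

theorem powerSeriesHom_injective : Function.Injective (powerSeriesHom I) :=
  HahnSeries.embDomain_injective.comp (HahnSeries.toMvPowerSeries (σ := I) (R := ℂ[X])).symm.injective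

theorem SupportedBelow.exists_powerSeries {f : CorootSeries I} (hf : SupportedBelow 0 f) :
    ∃ p, powerSeriesHom I p = f := by
  let p : MvPowerSeries I ℂ[X] := fun n => f.coeff (OrderDual.toDual (fun i => -(n i : ℤ)))
  refine ⟨p, ?_⟩
  ext x : 2
  obtain ⟨γ, rfl⟩ := OrderDual.toDual.surjective x
  by_cases h : γ ≤ 0
  · have : γ = fun i => -((Finsupp.equivFunOnFinite.symm (fun i => (-γ i).toNat) : I →₀ ℕ) i : ℤ) := by
      funext i
      have := h i
      simp only [Pi.zero_apply] at this
      simp; omega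
    rw [this, coeff_powerSeriesHom]
    rfl
  · rw [by_contra fun h' => h (hf γ h'), by_contra fun h' => h (powerSeriesHom_supportedBelow p γ h')]

theorem SupportedBelow.exists_inverse {f : CorootSeries I} (hf : SupportedBelow 0 f)
    (h0 : f.coeff 0 = 1) : ∃ g, SupportedBelow 0 g ∧ f * g = 1 := by
  obtain ⟨p, rfl⟩ := hf.exists_powerSeries
  have hz : (0 : (I → ℤ)ᵒᵈ) = OrderDual.toDual (fun i => -((0 : I →₀ ℕ) i : ℤ)) := by
    apply OrderDual.ofDual.injective
    funext i; simp
  have hp : IsUnit p := by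
    rw [MvPowerSeries.isUnit_iff_constantCoeff, ← MvPowerSeries.coeff_zero_eq_constantCoeff_apply,
      ← coeff_powerSeriesHom, ← hz, h0]
    exact isUnit_one
  obtain ⟨q, hq⟩ := hp.exists_right_inv
  exact ⟨powerSeriesHom I q, powerSeriesHom_supportedBelow q, by rw [← map_mul, hq, map_one]⟩

/-- Multiplication by a suitable e^{-μ} moves any series into the subring of power series in the
e^{-a_i^∨}, which is a domain. -/
instance : NoZeroDivisors (CorootSeries I) where
  eq_zero_or_eq_zero_of_mul_eq_zero := by
    intro f g h
    obtain ⟨μ, hμ⟩ := exists_supportedBelow f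
    obtain ⟨ν, hν⟩ := exists_supportedBelow g
    have h1 := (SupportedBelow.expS (-μ)).mul hμ
    have h2 := (SupportedBelow.expS (-ν)).mul hν
    rw [neg_add_cancel] at h1 h2
    obtain ⟨p, hp⟩ := h1.exists_powerSeries
    obtain ⟨q, hq⟩ := h2.exists_powerSeries
    have h3 : p * q = 0 := by
      apply powerSeriesHom_injective
      rw [map_mul, hp, hq, map_zero]
      linear_combination (expS (-μ) * expS (-ν)) * h
    have cancel : ∀ (μ : I → ℤ) (f : CorootSeries I), expS (-μ) * f = 0 → f = 0 := by
      intro μ f hf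
      linear_combination expS μ * hf - f * expS_mul_expS_neg μ
    rcases mul_eq_zero.mp h3 with h4 | h4
    · left; rw [h4, map_zero] at hp; exact cancel μ f hp.symm
    · right; rw [h4, map_zero] at hq; exact cancel ν g hq.symm

end Series

/-! ### Expansions of rational functions -/

section Expansion

variable {I : Type*}

@[simp]
theorem toSeries_single (γ : I → ℤ) (r : ℂ[X]) :
    toSeries I (AddMonoidAlgebra.single γ r) = HahnSeries.single (OrderDual.toDual γ) r := by
  rw [toSeries, AddMonoidAlgebra.lift_single]
  change r • HahnSeries.single (OrderDual.toDual γ) (1 : ℂ[X]) = _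
  rw [← HahnSeries.single_zero_mul_eq_smul, HahnSeries.single_mul_single, zero_add, mul_one]

theorem coeff_toSeries (d : CorootAlg I) (γ : I → ℤ) :
    (toSeries I d).coeff (OrderDual.toDual γ) = d.coeff γ := by
  classical
  induction d using AddMonoidAlgebra.induction_linear with
  | zero => simp
  | add f g hf hg => simp [hf, hg]
  | single δ r =>
    rw [toSeries_single, HahnSeries.coeff_single]
    simp [Finsupp.single_apply, eq_comm]

theorem toSeries_injective : Function.Injective (toSeries I) := by
  intro d e h
  ext γ
  rw [← coeff_toSeries, h, coeff_toSeries]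

theorem toSeries_ne_zero {d : CorootAlg I} (h : d ≠ 0) : toSeries I d ≠ 0 := fun h' =>
  h (toSeries_injective (by rw [h', map_zero]))

/-- The exponential `e^γ` in the group algebra. -/
def expA (γ : I → ℤ) : CorootAlg I := AddMonoidAlgebra.single γ 1

/-- The element `v⁻¹` of the group algebra. -/
def vInvA (I : Type*) : CorootAlg I := AddMonoidAlgebra.single 0 X

@[simp]
theorem toSeries_expA (γ : I → ℤ) : toSeries I (expA γ) = expS γ := toSeries_single γ 1

@[simp]
theorem toSeries_vInvA : toSeries I (vInvA I) = vInvS I := toSeries_single 0 X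

@[simp]
theorem expA_zero : expA (0 : I → ℤ) = 1 := rfl

theorem expA_mul_expA (γ δ : I → ℤ) : expA γ * expA δ = expA (γ + δ) := by
  simp [expA, AddMonoidAlgebra.single_mul_single]

theorem one_sub_expA_ne_zero {γ : I → ℤ} (h : γ ≠ 0) : 1 - expA γ ≠ 0 := by
  intro h'
  have := congrArg (fun d : CorootAlg I => d.coeff 0) h'
  simp [expA, AddMonoidAlgebra.one_def, h] at this

theorem one_sub_vInvA_mul_expA_ne_zero (γ : I → ℤ) : 1 - vInvA I * expA γ ≠ 0 := by
  classical
  intro h'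
  have := congrArg (fun d : CorootAlg I => (d.coeff 0).coeff 0) h'
  simp only [vInvA, expA, AddMonoidAlgebra.single_mul_single, AddMonoidAlgebra.one_def] at this
  simp [Finsupp.single_apply] at this
  split_ifs at this <;> simp at this

theorem algebraMap_injective : Function.Injective (algebraMap (CorootAlg I) (RatFun I)) :=
  IsFractionRing.injective _ _

theorem algebraMap_ne_zero {d : CorootAlg I} (h : d ≠ 0) :
    algebraMap (CorootAlg I) (RatFun I) d ≠ 0 := fun h' =>
  h (algebraMap_injective (by rw [h', map_zero]))

theorem algebraMap_expA (γ : I → ℤ) : algebraMap (CorootAlg I) (RatFun I) (expA γ) = expR γ := rfl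

theorem algebraMap_vInvA : algebraMap (CorootAlg I) (RatFun I) (vInvA I) = vInvR I := rfl

theorem expR_zero : expR (0 : I → ℤ) = 1 := by
  rw [← algebraMap_expA, expA_zero, map_one]

theorem expR_add (γ δ : I → ℤ) : expR (γ + δ) = expR γ * expR δ := by
  rw [← algebraMap_expA, ← expA_mul_expA, map_mul]; rfl

theorem expR_ne_zero (γ : I → ℤ) : expR γ ≠ 0 := by
  intro h
  have := expR_add γ (-γ)
  rw [h, add_neg_cancel, expR_zero, zero_mul] at this
  exact one_ne_zero this

theorem expR_neg (γ : I → ℤ) : expR (-γ) = (expR γ)⁻¹ := by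
  have := expR_add γ (-γ)
  rw [add_neg_cancel, expR_zero] at this
  exact eq_inv_of_mul_eq_one_right this.symm

theorem one_sub_expR_ne_zero {γ : I → ℤ} (h : γ ≠ 0) : 1 - expR γ ≠ 0 := by
  have := algebraMap_ne_zero (one_sub_expA_ne_zero h)
  rwa [map_sub, map_one] at this

theorem one_sub_vInvR_mul_expR_ne_zero (γ : I → ℤ) : 1 - vInvR I * expR γ ≠ 0 := by
  have := algebraMap_ne_zero (one_sub_vInvA_mul_expA_ne_zero γ)
  rwa [map_sub, map_one, map_mul] at this

variable [Fintype I]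

namespace IsExpansion

variable {r s : RatFun I} {f g : CorootSeries I}

/-- Cross-multiplied fractions agree in the group algebra, and nonzero denominators stay cancellable
among the series. This transfers identities of rational functions to their expansions. -/
theorem unique (h : IsExpansion r f) (h' : IsExpansion r g) : f = g := by
  obtain ⟨n, d, hd, h1, h2⟩ := h
  obtain ⟨n', d', hd', h1', h2'⟩ := h'
  have h3 : n * d' = n' * d := by
    apply algebraMap_injective
    rw [map_mul, map_mul, ← h1, ← h1']; ring
  have h4 : (f - g) * (toSeries I d * toSeries I d') = 0 := by
    have := congrArg (toSeries I) h3
    rw [map_mul, map_mul, ← h2, ← h2'] at this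
    linear_combination this
  rcases mul_eq_zero.mp h4 with h5 | h5
  · exact sub_eq_zero.mp h5
  · exact absurd h5 (mul_ne_zero (toSeries_ne_zero hd) (toSeries_ne_zero hd'))

theorem add (h : IsExpansion r f) (h' : IsExpansion s g) : IsExpansion (r + s) (f + g) := by
  obtain ⟨n, d, hd, h1, h2⟩ := h
  obtain ⟨n', d', hd', h1', h2'⟩ := h'
  refine ⟨n * d' + n' * d, d * d', mul_ne_zero hd hd', ?_, ?_⟩
  · simp only [map_mul, map_add, ← h1, ← h1']; ring
  · simp only [map_mul, map_add, ← h2, ← h2']; ring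

theorem mul (h : IsExpansion r f) (h' : IsExpansion s g) : IsExpansion (r * s) (f * g) := by
  obtain ⟨n, d, hd, h1, h2⟩ := h
  obtain ⟨n', d', hd', h1', h2'⟩ := h'
  refine ⟨n * n', d * d', mul_ne_zero hd hd', ?_, ?_⟩
  · simp only [map_mul, ← h1, ← h1']; ring
  · simp only [map_mul, ← h2, ← h2']; ring

theorem of_alg (d : CorootAlg I) :
    IsExpansion (algebraMap (CorootAlg I) (RatFun I) d) (toSeries I d) :=
  ⟨d, 1, one_ne_zero, by simp, by simp⟩

theorem zero : IsExpansion (0 : RatFun I) 0 := by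
  simpa using of_alg (I := I) 0

theorem one : IsExpansion (1 : RatFun I) 1 := by
  simpa using of_alg (I := I) 1

theorem expR (γ : I → ℤ) : IsExpansion (expR γ) (expS γ) := by
  rw [← toSeries_expA]; exact of_alg (expA γ)

theorem vInvR : IsExpansion (vInvR I) (vInvS I) := by
  rw [← toSeries_vInvA]; exact of_alg (vInvA I)

theorem neg (h : IsExpansion r f) : IsExpansion (-r) (-f) := by
  obtain ⟨n, d, hd, h1, h2⟩ := h
  exact ⟨-n, d, hd, by rw [map_neg, neg_mul, h1], by rw [map_neg]; linear_combination -h2⟩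

theorem sub (h : IsExpansion r f) (h' : IsExpansion s g) : IsExpansion (r - s) (f - g) := by
  rw [sub_eq_add_neg, sub_eq_add_neg]; exact h.add h'.neg

theorem inv_alg {d : CorootAlg I} (h : toSeries I d * f = 1) :
    IsExpansion (algebraMap (CorootAlg I) (RatFun I) d)⁻¹ f := by
  have hd : d ≠ 0 := by
    rintro rfl
    rw [map_zero, zero_mul] at h
    exact zero_ne_one h
  exact ⟨1, d, hd, by rw [map_one]; exact inv_mul_cancel₀ (algebraMap_ne_zero hd),
    by rw [map_one, mul_comm, h]⟩

end IsExpansion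

end Expansion

/-! ### Rational identities in ranks one and two -/

section RationalFunctions

variable {I : Type*} {γ : I → ℤ}

theorem one_sub_expR_inv : 1 - (expR γ)⁻¹ = -(1 - expR γ) / expR γ := by
  have h1 := expR_ne_zero γ
  field_simp
  ring

variable [Fintype I]

theorem cFun_eq (h : γ ≠ 0) :
    cFun γ = (expR γ - vInvR I) / (expR γ * (1 - expR γ)) := by
  have h1 := expR_ne_zero γ
  have h2 := one_sub_expR_ne_zero h
  rw [cFun, expR_neg]
  field_simp

theorem cFun_neg_eq (h : γ ≠ 0) :
    cFun (-γ) = -(expR γ * (1 - vInvR I * expR γ)) / (1 - expR γ) := by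
  have h1 := expR_ne_zero γ
  have h2 := one_sub_expR_ne_zero h
  rw [cFun, neg_neg, expR_neg, one_sub_expR_inv]
  field_simp

theorem bFun_neg_eq (h : γ ≠ 0) :
    bFun (-γ) = -((vInvR I - 1) * expR γ) / (1 - expR γ) := by
  have h1 := expR_ne_zero γ
  have h2 := one_sub_expR_ne_zero h
  rw [bFun, expR_neg, one_sub_expR_inv]
  field_simp

theorem cFun_ne_zero (h : γ ≠ 0) : cFun γ ≠ 0 :=
  div_ne_zero (one_sub_vInvR_mul_expR_ne_zero _) (one_sub_expR_ne_zero h)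

theorem bFun_ne_zero (h : γ ≠ 0) : bFun γ ≠ 0 := by
  refine div_ne_zero ?_ (one_sub_expR_ne_zero h)
  have := one_sub_vInvR_mul_expR_ne_zero (0 : I → ℤ)
  rw [expR_zero, mul_one] at this
  rw [← neg_sub]; exact neg_ne_zero.mpr this

/-- This and `cFun_mul_bFun_mul_cFun` are the functional identities behind the braid relation of
type A₂, with `γ` and `δ` in the role of the images of two adjacent simple coroots. -/
theorem bFun_mul_bFun {δ : I → ℤ} (hγ : γ ≠ 0) (hδ : δ ≠ 0) (hγδ : γ + δ ≠ 0) :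
    bFun (-γ) * bFun (γ + δ) + bFun δ * bFun γ = bFun (γ + δ) * bFun δ := by
  have h1 := one_sub_expR_ne_zero hγ
  have h2 := one_sub_expR_ne_zero hδ
  have h3 := one_sub_expR_ne_zero hγδ
  rw [bFun_neg_eq hγ, bFun, bFun, bFun]
  rw [expR_add] at h3 ⊢
  generalize expR γ = x at *
  generalize expR δ = y at *
  have h4 : 1 - y * x ≠ 0 := by rwa [mul_comm]
  field_simp
  ring

theorem cFun_mul_bFun_mul_cFun {δ : I → ℤ} (hγ : γ ≠ 0) (hδ : δ ≠ 0) (hγδ : γ + δ ≠ 0) :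
    cFun γ * bFun (γ + δ) * cFun (-γ) + bFun γ * bFun δ * bFun γ =
      cFun δ * bFun (γ + δ) * cFun (-δ) + bFun δ * bFun γ * bFun δ := by
  have h1 := one_sub_expR_ne_zero hγ
  have h2 := one_sub_expR_ne_zero hδ
  have h3 := one_sub_expR_ne_zero hγδ
  have h5 := expR_ne_zero γ
  have h6 := expR_ne_zero δ
  rw [cFun_eq hγ, cFun_eq hδ, cFun_neg_eq hγ, cFun_neg_eq hδ, bFun, bFun, bFun]
  rw [expR_add] at h3 ⊢
  generalize expR γ = x at *
  generalize expR δ = y at *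
  have h4 : 1 - y * x ≠ 0 := by rwa [mul_comm]
  field_simp
  ring

end RationalFunctions

/-! ### The Weyl group action on rational functions and the Hecke relations -/

namespace AffineDatum

variable {I : Type*} [Fintype I] [DecidableEq I] (D : AffineDatum I)

theorem smul_single (w : D.weylGroup) (γ : I → ℤ) (r : ℂ[X]) :
    w • (AddMonoidAlgebra.single γ r : CorootAlg I) = AddMonoidAlgebra.single (w.1 γ) r :=
  AddMonoidAlgebra.domCongr_single _ _ _

theorem smul_expA (w : D.weylGroup) (γ : I → ℤ) : w • expA γ = expA (w.1 γ) := D.smul_single w γ 1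

theorem smul_vInvA (w : D.weylGroup) : w • vInvA I = vInvA I := by
  rw [vInvA, smul_single, map_zero]

theorem coeff_smul_apply (w : D.weylGroup) (d : CorootAlg I) (γ : I → ℤ) :
    (w • d).coeff (w.1 γ) = d.coeff γ := by
  change (AddMonoidAlgebra.domCongr ℂ[X] ℂ[X] w.1.toAddEquiv d).coeff (w.1 γ) = _
  rw [AddMonoidAlgebra.coeff_domCongr]
  exact congrArg d.coeff (w.1.symm_apply_apply γ)

theorem smul_algebraMap (w : D.weylGroup) (d : CorootAlg I) :
    w • algebraMap (CorootAlg I) (RatFun I) d = algebraMap (CorootAlg I) (RatFun I) (w • d) :=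
  IsFractionRing.ringEquivOfRingEquiv_algebraMap _ _

theorem smul_expR (w : D.weylGroup) (γ : I → ℤ) : w • expR γ = expR (w.1 γ) := by
  rw [← algebraMap_expA, smul_algebraMap, smul_expA, algebraMap_expA]

theorem smul_vInvR (w : D.weylGroup) : w • vInvR I = vInvR I := by
  rw [← algebraMap_vInvA, smul_algebraMap, smul_vInvA]

theorem smul_div (w : D.weylGroup) (r s : RatFun I) : w • (r / s) = w • r / w • s :=
  map_div₀ (MulSemiringAction.toRingHom D.weylGroup (RatFun I) w) r s

theorem smul_cFun (w : D.weylGroup) (γ : I → ℤ) : w • cFun γ = cFun (w.1 γ) := by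
  simp only [cFun, smul_div, smul_sub, smul_one, smul_mul', smul_expR, smul_vInvR, map_neg]

theorem smul_bFun (w : D.weylGroup) (γ : I → ℤ) : w • bFun γ = bFun (w.1 γ) := by
  simp only [bFun, smul_div, smul_sub, smul_one, smul_expR, smul_vInvR]

theorem coeff_mul_T (F : D.RW) (i : I) (u : D.weylGroup) :
    (F * D.T i).coeff u = F.coeff (u * D.refl i) * cFun (-u.1 (D.simpleCoroot i)) +
      F.coeff u * bFun (u.1 (D.simpleCoroot i)) := by
  rw [T, mul_add, SkewMonoidAlgebra.coeff_add, Finsupp.add_apply,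
    SkewMonoidAlgebra.coeff_mul_single, SkewMonoidAlgebra.coeff_mul_single_one, refl_inv,
    smul_cFun, smul_bFun, mul_apply, refl_simpleCoroot, map_neg]

theorem coeff_T_mul (F : D.RW) (i : I) (u : D.weylGroup) :
    (D.T i * F).coeff u = cFun (D.simpleCoroot i) * D.refl i • F.coeff (D.refl i * u) +
      bFun (D.simpleCoroot i) * F.coeff u := by
  rw [T, add_mul, SkewMonoidAlgebra.coeff_add, Finsupp.add_apply,
    SkewMonoidAlgebra.coeff_single_mul, SkewMonoidAlgebra.coeff_single_mul, refl_inv,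
    inv_one, one_mul, one_smul]

theorem apply_simple_ne_zero (u : D.weylGroup) (i : I) : u.1 (D.simpleCoroot i) ≠ 0 :=
  ((IsRealCoroot.simple (D := D) i).apply u).ne_zero

/-- Right multiplication by T_i mixes only the coefficients at `u` and u w_i, so (T_i + 1)(T_i -
v⁻¹) = 0 becomes a rank-one identity in e^{u a_i^∨} and v⁻¹. -/
theorem coeff_mul_T_mul_T (F : D.RW) (i : I) (u : D.weylGroup) :
    (F * D.T i * D.T i).coeff u =
      (vInvR I - 1) * (F * D.T i).coeff u + vInvR I * F.coeff u := by
  have h0 := D.apply_simple_ne_zero u i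
  have h1 := expR_ne_zero (u.1 (D.simpleCoroot i))
  have h2 := one_sub_expR_ne_zero h0
  rw [coeff_mul_T, coeff_mul_T, coeff_mul_T]
  simp only [mul_refl_mul_refl, mul_apply, refl_simpleCoroot, map_neg, neg_neg]
  rw [cFun_eq h0, cFun_neg_eq h0, bFun_neg_eq h0, bFun]
  field_simp
  ring

theorem T_mul_T (i : I) : D.T i * D.T i =
    SkewMonoidAlgebra.single 1 (vInvR I - 1) * D.T i + SkewMonoidAlgebra.single 1 (vInvR I) := by
  ext u
  have := D.coeff_mul_T_mul_T 1 i u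
  rw [one_mul] at this
  rw [this, SkewMonoidAlgebra.coeff_add, Finsupp.add_apply, SkewMonoidAlgebra.coeff_single_mul,
    inv_one, one_mul, one_smul, SkewMonoidAlgebra.coeff_one, SkewMonoidAlgebra.coeff_single]
  congr 1
  classical
  rw [Finsupp.single_apply, Finsupp.single_apply]
  split_ifs <;> simp

theorem coeff_T_mul_T_mul (F : D.RW) (i : I) (u : D.weylGroup) :
    (D.T i * (D.T i * F)).coeff u =
      (vInvR I - 1) * (D.T i * F).coeff u + vInvR I * F.coeff u := by
  rw [← mul_assoc, T_mul_T, add_mul, mul_assoc, SkewMonoidAlgebra.coeff_add, Finsupp.add_apply,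
    SkewMonoidAlgebra.coeff_single_mul, SkewMonoidAlgebra.coeff_single_mul]
  simp

theorem refl_simple_of_A_eq {i j : I} {n : ℤ} (h : D.A i j = n) :
    (D.refl i).1 (D.simpleCoroot j) = D.simpleCoroot j - n • D.simpleCoroot i := by
  rw [refl_apply, form_simpleCoroot, h]

theorem refl_mul_refl_of_A_eq_zero {i j : I} (h : D.A i j = 0) :
    D.refl i * D.refl j = D.refl j * D.refl i :=
  D.mul_refl_eq_refl_mul (Or.inl (by rw [D.refl_simple_of_A_eq h]; simp))

theorem refl_braid_of_A_eq_neg_one {i j : I} (h : D.A i j = -1) :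
    D.refl i * D.refl j * D.refl i = D.refl j * (D.refl i * D.refl j) := by
  refine D.mul_refl_eq_refl_mul (Or.inl ?_)
  rw [mul_apply, D.refl_simple_of_A_eq ((D.A_comm j i).trans h), map_sub, map_smul,
    refl_simpleCoroot, D.refl_simple_of_A_eq h]
  module

theorem T_mul_T_of_A_eq_zero {i j : I} (h : D.A i j = 0) : D.T i * D.T j = D.T j * D.T i := by
  ext u
  rw [← one_mul (D.T i * D.T j), ← one_mul (D.T j * D.T i), ← mul_assoc, ← mul_assoc]
  have hij := D.refl_simple_of_A_eq h
  have hji := D.refl_simple_of_A_eq ((D.A_comm j i).trans h)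
  simp only [coeff_mul_T, mul_apply, hij, hji, zero_smul, sub_zero]
  rw [mul_assoc u, mul_assoc u, D.refl_mul_refl_of_A_eq_zero h]
  ring

theorem T_braid_of_A_eq_neg_one {i j : I} (h : D.A i j = -1) :
    D.T i * (D.T j * D.T i) = D.T j * (D.T i * D.T j) := by
  ext u
  have hij := D.refl_simple_of_A_eq h
  have hji := D.refl_simple_of_A_eq ((D.A_comm j i).trans h)
  rw [neg_one_smul, sub_neg_eq_add] at hij hji
  have hb := D.refl_braid_of_A_eq_neg_one h
  have hb' : u * D.refl i * D.refl j * D.refl i = u * D.refl j * D.refl i * D.refl j := by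
    have := congrArg (u * ·) hb
    simpa only [mul_assoc] using this
  rw [← one_mul (D.T i * _), ← one_mul (D.T j * (D.T i * _)), ← mul_assoc, ← mul_assoc,
    ← mul_assoc, ← mul_assoc]
  -- With an arbitrary left factor the relation becomes linear in the coefficients of `F`, which can
  -- be compared one by one.
  generalize (1 : D.RW) = F
  have hα := D.apply_simple_ne_zero u i
  have hβ := D.apply_simple_ne_zero u j
  have hγ : u.1 (D.simpleCoroot i) + u.1 (D.simpleCoroot j) ≠ 0 := by
    have := D.apply_simple_ne_zero (u * D.refl i) j
    rwa [mul_apply, hij, map_add, add_comm] at this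
  simp only [coeff_mul_T, mul_apply, hij, hji, refl_simpleCoroot, map_add, map_neg,
    mul_refl_mul_refl, neg_neg]
  rw [hb']
  set α := u.1 (D.simpleCoroot i) with hαd
  set β := u.1 (D.simpleCoroot j) with hβd
  rw [add_comm β α, show -α + (α + β) = β by abel, show -β + (α + β) = α by abel]
  have e1 := bFun_mul_bFun hα hβ hγ
  have e2 := bFun_mul_bFun hβ hα (by rwa [add_comm])
  have e3 := cFun_mul_bFun_mul_cFun hα hβ hγ
  rw [add_comm β α] at e2
  linear_combination F.coeff u * e3 + F.coeff (u * D.refl i) * cFun (-α) * e1 -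
    F.coeff (u * D.refl j) * cFun (-β) * e2

/-! ### Independence of the reduced word -/

theorem IsReduced.length_eq {D : AffineDatum I} {l l' : List I} (h : D.IsReduced l)
    (h' : D.IsReduced l') (he : D.wordProd l = D.wordProd l') : l.length = l'.length :=
  le_antisymm (h l' he.symm) (h' l he)

theorem IsReduced.head_descent {D : AffineDatum I} {l : List I} {i : I} (h : D.IsReduced (i :: l)) :
    (D.wordProd (i :: l))⁻¹.1 (D.simpleCoroot i) ≤ 0 := by
  have := h.apply_inv_nonneg
  rw [wordProd_cons, mul_inv_rev, refl_inv, mul_apply, refl_simpleCoroot, map_neg]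
  simpa using this

/-- If A_ij ≤ -2, then a_i^∨ + a_j^∨ has norm ≤ 0, hence is a multiple of `c` and fixed by `w`. But
`w` makes both summands negative. -/
theorem neg_one_le_A {w : D.weylGroup} {i j : I} (hi : w.1 (D.simpleCoroot i) ≤ 0)
    (hj : w.1 (D.simpleCoroot j) ≤ 0) : -1 ≤ D.A i j := by
  by_contra hcon
  have h1 : D.form (D.simpleCoroot i + D.simpleCoroot j) (D.simpleCoroot i + D.simpleCoroot j)
      = 4 + 2 * D.A i j := by
    simp only [map_add, LinearMap.add_apply, form_simpleCoroot, D.diag, D.A_comm j i]; ring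
  have h2 := D.form_self_nonneg (D.simpleCoroot i + D.simpleCoroot j)
  obtain ⟨n, hn⟩ := D.eq_smul_c_of_form_self_eq_zero (x := D.simpleCoroot i + D.simpleCoroot j)
    (by omega)
  have h3 : w.1 (D.simpleCoroot i + D.simpleCoroot j) = D.simpleCoroot i + D.simpleCoroot j := by
    rw [hn, map_smul, apply_c]
  rw [map_add] at h3
  have h4 : D.simpleCoroot i + D.simpleCoroot j ≤ 0 := by
    rw [← h3]; exact add_nonpos hi hj
  exact D.simple_ne_nonpos i ((le_add_of_nonneg_right (D.simpleCoroot_nonneg j)).trans h4)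

/-- The product `T_{i_1} ⋯ T_{i_r}` only depends on the element spelled by a reduced word. -/
theorem prod_T_eq {l l' : List I} (hl : D.IsReduced l) (hl' : D.IsReduced l')
    (h : D.wordProd l = D.wordProd l') : (l.map D.T).prod = (l'.map D.T).prod := by
  induction hn : l.length using Nat.strong_induction_on generalizing l l' with
  | _ n ih =>
  subst hn
  have hlen := hl.length_eq hl' h
  match l, l', hl, hl', h, hlen, ih with
  | [], [], _, _, _, _, _ => rfl
  | i :: l, j :: l', hl, hl', h, hlen, ih =>
    have rl : D.IsReduced l := IsReduced.right (l := [i]) hl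
    have rl' : D.IsReduced l' := IsReduced.right (l := [j]) hl'
    have IH : ∀ {m m' : List I}, m.length ≤ l.length → D.IsReduced m → D.IsReduced m' →
        D.wordProd m = D.wordProd m' → (m.map D.T).prod = (m'.map D.T).prod :=
      fun {m m'} h1 h2 h3 h4 => ih m.length (by simpa using Nat.lt_succ_of_le h1) h2 h3 h4 rfl
    simp only [List.length_cons, add_left_inj] at hlen
    simp only [List.map_cons, List.prod_cons]
    have hli := hl.head_descent
    have hlj := hl'.head_descent
    rw [← h] at hlj
    rw [wordProd_cons, wordProd_cons] at h
    rw [wordProd_cons] at hli hlj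
    by_cases hij : i = j
    · subst hij
      rw [IH le_rfl rl rl' (mul_left_cancel h)]
    -- Both first letters are left descents of the same element, which excludes every rank-two
    -- relation but the commutation and the braid of length three.
    have hA := D.neg_one_le_A hli hlj
    have hA' := D.offDiag i j hij
    have hA2 : D.A i j = 0 ∨ D.A i j = -1 := by omega
    have e1 : (D.wordProd l)⁻¹ = (D.refl i * D.wordProd l)⁻¹ * D.refl i := by
      rw [mul_inv_rev, refl_inv, mul_refl_mul_refl]
    have e2 : (D.wordProd l')⁻¹ = (D.refl i * D.wordProd l)⁻¹ * D.refl j := by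
      rw [h, mul_inv_rev, refl_inv, mul_refl_mul_refl]
    rcases hA2 with hA0 | hA1
    · have hs := D.refl_simple_of_A_eq hA0
      have hs' := D.refl_simple_of_A_eq ((D.A_comm j i).trans hA0)
      rw [zero_smul, sub_zero] at hs hs'
      obtain ⟨m, hm, hmw⟩ := D.exists_reduced_cons (w := D.wordProd l) (i := j) (by
        rwa [e1, mul_apply, hs])
      obtain ⟨m', hm', hmw'⟩ := D.exists_reduced_cons (w := D.wordProd l') (i := i) (by
        rwa [e2, mul_apply, hs'])
      have k1 : D.wordProd l = D.wordProd (j :: m) := by rw [wordProd_cons, hmw, refl_mul_refl_mul]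
      have k2 : D.wordProd l' = D.wordProd (i :: m') := by
        rw [wordProd_cons, hmw', refl_mul_refl_mul]
      have k3 : D.wordProd m = D.wordProd m' := by
        have hc := D.refl_mul_refl_of_A_eq_zero hA0
        apply mul_left_cancel (a := D.refl i * D.refl j)
        rw [hmw, hmw', mul_assoc, refl_mul_refl_mul, h, hc, mul_assoc, refl_mul_refl_mul]
      have len1 := rl.length_eq hm k1
      have len2 := rl'.length_eq hm' k2
      simp only [List.length_cons] at len1 len2
      have t1 := IH le_rfl rl hm k1
      have t2 := IH hlen.ge rl' hm' k2
      have t3 := IH (by omega) (IsReduced.right (l := [j]) hm) (IsReduced.right (l := [i]) hm') k3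
      rw [t1, t2, List.map_cons, List.prod_cons, List.map_cons, List.prod_cons, t3, ← mul_assoc,
        D.T_mul_T_of_A_eq_zero hA0, mul_assoc]
    · have hs := D.refl_simple_of_A_eq hA1
      have hs' := D.refl_simple_of_A_eq ((D.A_comm j i).trans hA1)
      rw [neg_one_smul, sub_neg_eq_add] at hs hs'
      have hc := D.refl_braid_of_A_eq_neg_one hA1
      -- The two words are compared, through tails shorter than themselves, with reduced words
      -- beginning i j i and j i j whose remainders `p`, `p'` spell the same element.
      obtain ⟨m, hm, hmw⟩ := D.exists_reduced_cons (w := D.wordProd l) (i := j) (by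
        rw [e1, mul_apply, hs, map_add]; exact add_nonpos hlj hli)
      obtain ⟨m', hm', hmw'⟩ := D.exists_reduced_cons (w := D.wordProd l') (i := i) (by
        rw [e2, mul_apply, hs', map_add]; exact add_nonpos hli hlj)
      have k1 : D.wordProd l = D.wordProd (j :: m) := by rw [wordProd_cons, hmw, refl_mul_refl_mul]
      have k2 : D.wordProd l' = D.wordProd (i :: m') := by
        rw [wordProd_cons, hmw', refl_mul_refl_mul]
      have rm : D.IsReduced m := IsReduced.right (l := [j]) hm
      have rm' : D.IsReduced m' := IsReduced.right (l := [i]) hm'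
      have e3 : (D.wordProd m)⁻¹ = (D.refl i * D.wordProd l)⁻¹ * D.refl i * D.refl j := by
        rw [hmw, mul_inv_rev, refl_inv, e1]
      have e4 : (D.wordProd m')⁻¹ = (D.refl i * D.wordProd l)⁻¹ * D.refl j * D.refl i := by
        rw [hmw', mul_inv_rev, refl_inv, e2]
      obtain ⟨p, hp, hpw⟩ := D.exists_reduced_cons (w := D.wordProd m) (i := i) (by
        rw [e3, mul_apply, hs', mul_apply, map_add, hs, refl_simpleCoroot]
        simpa using hlj)
      obtain ⟨p', hp', hpw'⟩ := D.exists_reduced_cons (w := D.wordProd m') (i := j) (by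
        rw [e4, mul_apply, hs, mul_apply, map_add, hs', refl_simpleCoroot]
        simpa using hli)
      have k3 : D.wordProd m = D.wordProd (i :: p) := by rw [wordProd_cons, hpw, refl_mul_refl_mul]
      have k4 : D.wordProd m' = D.wordProd (j :: p') := by
        rw [wordProd_cons, hpw', refl_mul_refl_mul]
      have k5 : D.wordProd p = D.wordProd p' := by
        apply mul_left_cancel (a := D.refl i * D.refl j * D.refl i)
        rw [hpw, hpw', hmw, hmw']
        nth_rewrite 2 [hc]
        simp only [mul_assoc, refl_mul_refl_mul]
        exact h
      have len1 := rl.length_eq hm k1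
      have len2 := rl'.length_eq hm' k2
      have len3 := rm.length_eq hp k3
      have len4 := rm'.length_eq hp' k4
      simp only [List.length_cons] at len1 len2 len3 len4
      have t1 := IH le_rfl rl hm k1
      have t2 := IH hlen.ge rl' hm' k2
      have t3 := IH (by omega) rm hp k3
      have t4 := IH (by omega) rm' hp' k4
      have t5 := IH (by omega) (IsReduced.right (l := [i]) hp) (IsReduced.right (l := [j]) hp') k5
      simp only [List.map_cons, List.prod_cons] at t1 t2 t3 t4
      rw [t1, t2, t3, t4, t5]
      have := D.T_braid_of_A_eq_neg_one hA1
      calc _ = D.T i * (D.T j * D.T i) * (p'.map D.T).prod := by simp only [mul_assoc]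
        _ = _ := by rw [this]; simp only [mul_assoc]

end AffineDatum

/-! ### Expansion of Hecke coefficients along folded galleries -/

theorem exists_geometric {I : Type*} [Fintype I] {β : I → ℤ} (h : 0 ≤ β) (h0 : β ≠ 0) :
    ∃ g : CorootSeries I, SupportedBelow 0 g ∧ toSeries I (1 - expA (-β)) * g = 1 := by
  refine SupportedBelow.exists_inverse ?_ ?_
  · rw [map_sub, map_one, toSeries_expA]
    exact SupportedBelow.one.sub ((SupportedBelow.expS _).mono (by simpa using h))
  · change (toSeries I (1 - expA (-β))).coeff (OrderDual.toDual 0) = 1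
    rw [coeff_toSeries]
    simp [expA, AddMonoidAlgebra.one_def, h0]

namespace AffineDatum

variable {I : Type*} [Fintype I] [DecidableEq I] {D : AffineDatum I}

/-- The expansion depends on the sign of `β`. For β > 0 it is -e^{-β} - e^{-2β} - ⋯, and the gain of
-β is what a positive fold records. -/
theorem IsRealCoroot.exists_expansion_inv {β : I → ℤ} (h : D.IsRealCoroot β) :
    ∃ g, IsExpansion (1 - expR β)⁻¹ g ∧ SupportedBelow 0 g ∧ (0 ≤ β → SupportedBelow (-β) g) := by
  rcases h.nonneg_or_nonpos with h0 | h0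
  · obtain ⟨g, hg, hg1⟩ := exists_geometric h0 h.ne_zero
    have h1 : (1 - expR β)⁻¹ = -(expR (-β) * (1 - expR (-β))⁻¹) := by
      have h2 := expR_ne_zero β
      have h3 := one_sub_expR_ne_zero h.ne_zero
      rw [expR_neg, one_sub_expR_inv]
      field_simp
    have h4 := IsExpansion.inv_alg hg1
    rw [map_sub, map_one, algebraMap_expA] at h4
    have h5 : SupportedBelow (-β) (-(expS (-β) * g)) := by
      have := (SupportedBelow.expS (-β)).mul hg
      rw [add_zero] at this
      exact this.neg
    refine ⟨-(expS (-β) * g), ?_, h5.mono (by simpa using h0), fun _ => h5⟩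
    rw [h1]; exact ((IsExpansion.expR _).mul h4).neg
  · obtain ⟨g, hg, hg1⟩ := exists_geometric (β := -β) (by simpa using h0) (neg_ne_zero.mpr h.ne_zero)
    have h4 := IsExpansion.inv_alg hg1
    rw [neg_neg, map_sub, map_one, algebraMap_expA] at h4
    exact ⟨g, h4, hg, fun h' => absurd (le_antisymm h0 h') h.ne_zero⟩

theorem IsRealCoroot.exists_expansion_bFun {β : I → ℤ} (h : D.IsRealCoroot β) :
    ∃ g, IsExpansion (bFun β) g ∧ SupportedBelow 0 g ∧ (0 ≤ β → SupportedBelow (-β) g) := by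
  obtain ⟨g, h1, h2, h3⟩ := h.exists_expansion_inv
  have hv : SupportedBelow 0 (vInvS I - 1) := SupportedBelow.vInvS.sub SupportedBelow.one
  refine ⟨(vInvS I - 1) * g, ?_, ?_, fun h0 => ?_⟩
  · rw [bFun, div_eq_mul_inv]
    exact (IsExpansion.vInvR.sub IsExpansion.one).mul h1
  · simpa using hv.mul h2
  · simpa using hv.mul (h3 h0)

/-- The bound -β holds for both signs: it comes from 1/(1 - e^β) if β > 0 and from the numerator if
β < 0. -/
theorem IsRealCoroot.exists_expansion_cFun {β : I → ℤ} (h : D.IsRealCoroot β) :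
    ∃ g, IsExpansion (cFun β) g ∧ SupportedBelow (-β) g := by
  obtain ⟨g, h1, h2, h3⟩ := h.exists_expansion_inv
  have h4 : IsExpansion (1 - vInvR I * expR (-β)) (1 - vInvS I * expS (-β)) :=
    IsExpansion.one.sub (IsExpansion.vInvR.mul (IsExpansion.expR _))
  have h6 := SupportedBelow.vInvS.mul (SupportedBelow.expS (-β))
  rw [zero_add] at h6
  refine ⟨(1 - vInvS I * expS (-β)) * g, ?_, ?_⟩
  · rw [cFun, div_eq_mul_inv]
    exact h4.mul h1
  · rcases h.nonneg_or_nonpos with h0 | h0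
    · have h5 : SupportedBelow 0 (1 - vInvS I * expS (-β)) :=
        SupportedBelow.one.sub (h6.mono (by simpa using h0))
      simpa using h5.mul (h3 h0)
    · have h5 : SupportedBelow (-β) (1 - vInvS I * expS (-β)) :=
        (SupportedBelow.one.mono (by simpa using h0)).sub h6
      simpa using h5.mul h2

variable (D)

/-- In the recursion for right multiplication by T_i, the 𝐜-term is a crossing: its bound u a_i^∨ is
exactly compensated by the change of ρ - uρ. The 𝐛-term is a fold, which lowers the exponent by u
a_i^∨ when that coroot is positive and gives no gain otherwise. -/
theorem exists_expansion_prod_T (l : List I) (u : D.weylGroup) :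
    ∃ f, IsExpansion ((l.map D.T).prod.coeff u) f ∧
      ∀ γ, f.coeff (OrderDual.toDual γ) ≠ 0 → ∃ σ, D.FoldedPath l u σ ∧ γ ≤ -D.invSum u - σ := by
  induction l using List.reverseRecOn generalizing u with
  | nil =>
    classical
    rw [List.map_nil, List.prod_nil, SkewMonoidAlgebra.coeff_one]
    by_cases h : 1 = u
    · subst h
      refine ⟨1, by rw [Finsupp.single_eq_same]; exact IsExpansion.one, fun γ hγ => ⟨0, .nil, ?_⟩⟩
      rw [invSum_one]
      simpa using SupportedBelow.one γ hγ
    · exact ⟨0, by rw [Finsupp.single_eq_of_ne (Ne.symm h)]; exact IsExpansion.zero, fun γ hγ => by simp at hγ⟩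
  | append_singleton l i ih =>
    have hr := (IsRealCoroot.simple (D := D) i).apply u
    obtain ⟨f, hf, hf'⟩ := ih u
    obtain ⟨g, hg, hg'⟩ := ih (u * D.refl i)
    obtain ⟨c, hc, hc'⟩ := hr.neg.exists_expansion_cFun
    obtain ⟨b, hb, hb', hb''⟩ := hr.exists_expansion_bFun
    rw [neg_neg] at hc'
    refine ⟨g * c + f * b, ?_, fun γ hγ => ?_⟩
    · rw [List.map_append, List.prod_append, List.map_singleton, List.prod_singleton, coeff_mul_T]
      exact (hg.mul hc).add (hf.mul hb)
    · have hor : (g * c).coeff (OrderDual.toDual γ) ≠ 0 ∨ (f * b).coeff (OrderDual.toDual γ) ≠ 0 := by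
        by_contra hcon
        push Not at hcon
        exact hγ (by rw [HahnSeries.coeff_add, hcon.1, hcon.2, add_zero])
      rcases hor with h | h
      · obtain ⟨x, y, hx, hy, rfl⟩ := exists_coeff_ne_zero_of_mul h
        obtain ⟨σ, hσ, hxσ⟩ := hg' x hx
        refine ⟨σ, by simpa using hσ.cross i, (add_le_add hxσ (hc' y hy)).trans (le_of_eq ?_)⟩
        rw [invSum_mul_refl]; abel
      · obtain ⟨x, y, hx, hy, rfl⟩ := exists_coeff_ne_zero_of_mul h
        obtain ⟨σ, hσ, hxσ⟩ := hf' x hx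
        rcases hr.nonneg_or_nonpos with h0 | h0
        · refine ⟨_, hσ.foldPos i h0, (add_le_add hxσ (hb'' h0 y hy)).trans (le_of_eq ?_)⟩
          abel
        · refine ⟨_, hσ.foldNeg i h0, (add_le_add hxσ (hb' y hy)).trans (le_of_eq ?_)⟩
          abel

/-! ### The elements T_w and their sum -/

/-- The element `T_w`. -/
def heckeBasis (w : D.weylGroup) : D.RW := ((D.exists_reduced w).choose.map D.T).prod

variable {D}

theorem IsReduced.prod_T {l : List I} (h : D.IsReduced l) :
    (l.map D.T).prod = D.heckeBasis (D.wordProd l) :=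
  D.prod_T_eq h (D.exists_reduced _).choose_spec.1 (D.exists_reduced _).choose_spec.2.symm

variable (D)

theorem heckeBasis_mul_refl {w : D.weylGroup} {i : I} (h : 0 ≤ w.1 (D.simpleCoroot i)) :
    D.heckeBasis (w * D.refl i) = D.heckeBasis w * D.T i := by
  obtain ⟨l, hl, rfl⟩ := D.exists_reduced w
  have h1 := (hl.append h).prod_T
  rw [List.map_append, List.prod_append, List.map_singleton, List.prod_singleton, hl.prod_T] at h1
  rw [h1]; simp

theorem heckeBasis_refl_mul {w : D.weylGroup} {i : I} (h : 0 ≤ w⁻¹.1 (D.simpleCoroot i)) :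
    D.heckeBasis (D.refl i * w) = D.T i * D.heckeBasis w := by
  obtain ⟨l, hl, rfl⟩ := D.exists_reduced w
  have h1 := (hl.cons h).prod_T
  rw [List.map_cons, List.prod_cons, hl.prod_T] at h1
  rw [h1]; simp

/-- The expansion of the coefficient of `[u]` in `T_w`. -/
def heckeCoeff (u w : D.weylGroup) : CorootSeries I :=
  (D.exists_expansion_prod_T (D.exists_reduced w).choose u).choose

theorem heckeCoeff_isExpansion (u w : D.weylGroup) :
    IsExpansion ((D.heckeBasis w).coeff u) (D.heckeCoeff u w) :=
  (D.exists_expansion_prod_T (D.exists_reduced w).choose u).choose_spec.1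

theorem exists_path_of_heckeCoeff {u w : D.weylGroup} {γ : I → ℤ}
    (h : (D.heckeCoeff u w).coeff (OrderDual.toDual γ) ≠ 0) :
    ∃ l σ, D.IsReduced l ∧ D.wordProd l = w ∧ D.FoldedPath l u σ ∧ γ ≤ -D.invSum u - σ := by
  obtain ⟨σ, h1, h2⟩ := (D.exists_expansion_prod_T (D.exists_reduced w).choose u).choose_spec.2 γ h
  exact ⟨_, σ, (D.exists_reduced w).choose_spec.1, (D.exists_reduced w).choose_spec.2, h1, h2⟩

theorem heckeCoeff_supportedBelow (u w : D.weylGroup) : SupportedBelow 0 (D.heckeCoeff u w) := by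
  intro γ h
  obtain ⟨l, σ, -, -, hp, hγ⟩ := D.exists_path_of_heckeCoeff h
  refine hγ.trans ?_
  rw [sub_nonpos]
  exact (neg_nonpos.mpr (D.invSum_nonneg u)).trans hp.nonneg

theorem finite_heckeCoeff (u : D.weylGroup) (γ : I → ℤ) :
    {w | (D.heckeCoeff u w).coeff (OrderDual.toDual γ) ≠ 0}.Finite := by
  refine (D.finite_foldedPath u (-γ)).subset fun w hw => ?_
  obtain ⟨l, σ, hl, hlw, hp, hγ⟩ := D.exists_path_of_heckeCoeff hw
  refine ⟨l, σ, hl, hlw, hp, ?_⟩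
  have h1 := D.invSum_nonneg u
  have : σ ≤ -γ - D.invSum u := by
    intro i
    have := hγ i
    simp only [Pi.sub_apply, Pi.neg_apply] at this ⊢
    omega
  exact this.trans (sub_le_self _ h1)

/-- The summable family `w ↦ C_u(w)`. -/
def heckeFamily (u : D.weylGroup) : HahnSeries.SummableFamily (I → ℤ)ᵒᵈ ℂ[X] D.weylGroup where
  toFun w := D.heckeCoeff u w
  isPWO_iUnion_support' := by
    refine isPWO_Iic_zero.mono (Set.iUnion_subset fun w x hx => ?_)
    exact D.heckeCoeff_supportedBelow u w (OrderDual.ofDual x) hx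
  finite_co_support' := fun x => D.finite_heckeCoeff u (OrderDual.ofDual x)

/-- The coefficients `C_u` of the symmetrizer. -/
def symmetrizer (u : D.weylGroup) : CorootSeries I := (D.heckeFamily u).hsum

theorem coeff_symmetrizer (u : D.weylGroup) (γ : I → ℤ) :
    (D.symmetrizer u).coeff (OrderDual.toDual γ) =
      ∑ᶠ w, (D.heckeCoeff u w).coeff (OrderDual.toDual γ) :=
  HahnSeries.SummableFamily.coeff_hsum

theorem symmetrizer_supportedBelow (u : D.weylGroup) : SupportedBelow 0 (D.symmetrizer u) := by
  intro γ h
  rw [coeff_symmetrizer] at h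
  obtain ⟨w, hw⟩ : ∃ w, (D.heckeCoeff u w).coeff (OrderDual.toDual γ) ≠ 0 := by
    by_contra hcon
    push Not at hcon
    exact h (finsum_eq_zero_of_forall_eq_zero hcon)
  exact D.heckeCoeff_supportedBelow u w γ hw

/-- Uniqueness of expansions and independence of the reduced word leave no choice for the C_u(w),
hence none for their sums. -/
theorem isSymmetrizer_iff (P : D.weylGroup → CorootSeries I) :
    D.IsSymmetrizer P ↔ P = D.symmetrizer := by
  constructor
  · rintro ⟨C, hC, hP⟩
    have h1 : C = D.heckeCoeff := by
      funext u w
      obtain ⟨l, hl, rfl⟩ := D.exists_reduced w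
      have h2 := hC l hl u
      rw [hl.prod_T] at h2
      exact h2.unique (D.heckeCoeff_isExpansion u _)
    funext u
    ext x : 2
    rw [show x = OrderDual.toDual (OrderDual.ofDual x) from rfl, (hP u _).2, coeff_symmetrizer, h1]
  · rintro rfl
    refine ⟨D.heckeCoeff, fun l hl u => ?_, fun u γ => ⟨D.finite_heckeCoeff u γ, ?_⟩⟩
    · rw [hl.prod_T]; exact D.heckeCoeff_isExpansion u _
    · exact D.coeff_symmetrizer u γ

end AffineDatum

/-- Reindexing by `e` shows that twice the sum is zero. It allows cancellation in pairs w, w w_a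
without choosing a representative of each pair. -/
theorem finsum_eq_zero_of_add_apply_eq_zero {α : Type*} (k : α → ℂ[X]) (e : α ≃ α)
    (hk : k.HasFiniteSupport) (h : ∀ a, k a + k (e a) = 0) : ∑ᶠ a, k a = 0 := by
  have h1 : ∑ᶠ a, k (e a) = ∑ᶠ a, k a := finsum_comp_equiv e
  have h2 : Function.HasFiniteSupport fun a => k (e a) := hk.preimage e.injective.injOn
  have h3 := finsum_add_distrib hk h2
  rw [finsum_eq_zero_of_forall_eq_zero h, h1] at h3
  exact add_self_eq_zero.mp h3.symm

/-! ### The right eigenvalue equation -/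

namespace AffineDatum

variable {I : Type*} [Fintype I] [DecidableEq I] (D : AffineDatum I)

theorem smul_heckeFamily_apply (x : CorootSeries I) (u w : D.weylGroup) :
    (x • D.heckeFamily u) w = x * D.heckeCoeff u w := by
  rw [HahnSeries.SummableFamily.smul_apply, HahnSeries.of_symm_smul_of_eq_mul]
  rfl

theorem coeff_mul_symmetrizer (x : CorootSeries I) (u : D.weylGroup) (γ : I → ℤ) :
    (x * D.symmetrizer u).coeff (OrderDual.toDual γ) =
      ∑ᶠ w, (x * D.heckeCoeff u w).coeff (OrderDual.toDual γ) := by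
  rw [symmetrizer, ← HahnSeries.SummableFamily.hsum_smul,
    HahnSeries.SummableFamily.coeff_hsum]
  simp only [smul_heckeFamily_apply]

theorem finite_mul_heckeCoeff (x : CorootSeries I) (u : D.weylGroup) (γ : I → ℤ) :
    Function.HasFiniteSupport fun w => (x * D.heckeCoeff u w).coeff (OrderDual.toDual γ) := by
  have := (x • D.heckeFamily u).finite_co_support (OrderDual.toDual γ)
  simpa only [smul_heckeFamily_apply] using this

/-- If w a_i^∨ > 0, then T_w + T_{w w_i} = T_w(1 + T_i), and T_i acts on it from the right by v⁻¹.
The sum is symmetric in w and w w_i, so the sign condition can be dropped. -/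
theorem heckeCoeff_right_pair {i : I} {u w : D.weylGroup} {c b : CorootSeries I}
    (hc : IsExpansion (cFun (-u.1 (D.simpleCoroot i))) c)
    (hb : IsExpansion (bFun (u.1 (D.simpleCoroot i))) b) :
    c * (D.heckeCoeff (u * D.refl i) w + D.heckeCoeff (u * D.refl i) (w * D.refl i)) +
      (b - vInvS I) * (D.heckeCoeff u w + D.heckeCoeff u (w * D.refl i)) = 0 := by
  have key : ∀ w : D.weylGroup, 0 ≤ w.1 (D.simpleCoroot i) →
      c * (D.heckeCoeff (u * D.refl i) w + D.heckeCoeff (u * D.refl i) (w * D.refl i)) +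
      (b - vInvS I) * (D.heckeCoeff u w + D.heckeCoeff u (w * D.refl i)) = 0 := by
    intro w h
    have h1 := D.heckeBasis_mul_refl h
    have e1 := D.coeff_mul_T (D.heckeBasis w) i u
    have e2 := D.coeff_mul_T_mul_T (D.heckeBasis w) i u
    rw [← h1, coeff_mul_T] at e2
    rw [← h1] at e1
    have f1 := (D.heckeCoeff_isExpansion u (w * D.refl i)).unique (e1 ▸
      ((D.heckeCoeff_isExpansion (u * D.refl i) w).mul hc).add
        ((D.heckeCoeff_isExpansion u w).mul hb))
    have f2 := (e2 ▸ ((D.heckeCoeff_isExpansion (u * D.refl i) (w * D.refl i)).mul hc).add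
        ((D.heckeCoeff_isExpansion u (w * D.refl i)).mul hb)).unique
      (((IsExpansion.vInvR.sub IsExpansion.one).mul
        (D.heckeCoeff_isExpansion u (w * D.refl i))).add
        (IsExpansion.vInvR.mul (D.heckeCoeff_isExpansion u w)))
    linear_combination f2 - f1
  rcases ((IsRealCoroot.simple (D := D) i).apply w).nonneg_or_nonpos with h | h
  · exact key w h
  · have := key (w * D.refl i) (by simpa using h)
    rw [mul_refl_mul_refl] at this
    linear_combination this

theorem symmetrizer_right {i : I} {u : D.weylGroup} {c b : CorootSeries I}
    (hc : IsExpansion (cFun (-u.1 (D.simpleCoroot i))) c)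
    (hb : IsExpansion (bFun (u.1 (D.simpleCoroot i))) b) :
    D.symmetrizer (u * D.refl i) * c + D.symmetrizer u * b = vInvS I * D.symmetrizer u := by
  have h : c * D.symmetrizer (u * D.refl i) + (b - vInvS I) * D.symmetrizer u = 0 := by
    ext x : 2
    obtain ⟨γ, rfl⟩ := OrderDual.toDual.surjective x
    rw [HahnSeries.coeff_add, coeff_mul_symmetrizer, coeff_mul_symmetrizer,
      ← finsum_add_distrib (D.finite_mul_heckeCoeff _ _ _) (D.finite_mul_heckeCoeff _ _ _)]
    refine finsum_eq_zero_of_add_apply_eq_zero _ (Equiv.mulRight (D.refl i)) ?_ fun w => ?_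
    · exact (D.finite_mul_heckeCoeff _ _ _).add (D.finite_mul_heckeCoeff _ _ _)
    · have := congrArg (fun f : CorootSeries I => f.coeff (OrderDual.toDual γ))
        (D.heckeCoeff_right_pair (w := w) hc hb)
      simp only [mul_add, HahnSeries.coeff_add, HahnSeries.coeff_zero] at this
      rw [← this]
      simp only [Equiv.coe_mulRight]
      ring
  linear_combination h

theorem refl_ne_one (i : I) : D.refl i ≠ 1 := by
  intro h
  have h1 := D.refl_simpleCoroot i
  rw [h, one_apply] at h1
  have := congrFun h1 i
  simp [simpleCoroot] at this

theorem coeff_T_refl (i : I) : (D.T i).coeff (D.refl i) = cFun (D.simpleCoroot i) := by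
  rw [T, SkewMonoidAlgebra.coeff_add, Finsupp.add_apply, SkewMonoidAlgebra.coeff_single,
    SkewMonoidAlgebra.coeff_single, Finsupp.single_eq_same,
    Finsupp.single_eq_of_ne (D.refl_ne_one i), add_zero]

theorem coeff_T_one (i : I) : (D.T i).coeff 1 = bFun (D.simpleCoroot i) := by
  rw [T, SkewMonoidAlgebra.coeff_add, Finsupp.add_apply, SkewMonoidAlgebra.coeff_single,
    SkewMonoidAlgebra.coeff_single, Finsupp.single_eq_same,
    Finsupp.single_eq_of_ne (D.refl_ne_one i).symm, zero_add]

theorem mem_support_T {i : I} {y : D.weylGroup} :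
    y ∈ (D.T i).support ↔ y = D.refl i ∨ y = 1 := by
  rw [SkewMonoidAlgebra.mem_support_iff]
  have h0 := (IsRealCoroot.simple (D := D) i).ne_zero
  constructor
  · intro h
    by_contra hcon
    push Not at hcon
    apply h
    rw [T, SkewMonoidAlgebra.coeff_add, Finsupp.add_apply, SkewMonoidAlgebra.coeff_single,
      SkewMonoidAlgebra.coeff_single, Finsupp.single_eq_of_ne hcon.1,
      Finsupp.single_eq_of_ne hcon.2, add_zero]
  · rintro (rfl | rfl)
    · rw [coeff_T_refl]; exact cFun_ne_zero h0
    · rw [coeff_T_one]; exact bFun_ne_zero h0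

theorem sum_support_T (i : I) (f : D.weylGroup → CorootSeries I) :
    ∑ y ∈ (D.T i).support, f y = f (D.refl i) + f 1 := by
  classical
  have : (D.T i).support = {D.refl i, 1} := by
    ext y
    rw [mem_support_T, Finset.mem_insert, Finset.mem_singleton]
  rw [this, Finset.sum_pair (D.refl_ne_one i)]

theorem isRightProd_symmetrizer (i : I) :
    D.IsRightProd D.symmetrizer (D.T i) (fun u => vInvS I * D.symmetrizer u) := by
  classical
  have hr : ∀ u : D.weylGroup, D.IsRealCoroot (u.1 (D.simpleCoroot i)) := fun u =>
    (IsRealCoroot.simple (D := D) i).apply u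
  choose c hc using fun u => (hr u).neg.exists_expansion_cFun
  choose b hb using fun u => (hr u).exists_expansion_bFun
  refine ⟨fun y u => if y = D.refl i then c u else b u, ?_, ?_⟩
  · intro y hy u
    rcases D.mem_support_T.mp hy with rfl | rfl
    · simp only [if_true]
      rw [coeff_T_refl, smul_cFun, refl_inv, mul_apply, refl_simpleCoroot, map_neg]
      exact (hc u).1
    · simp only [(D.refl_ne_one i).symm, if_false]
      rw [coeff_T_one, smul_bFun, inv_one, mul_one]
      exact (hb u).1
  · intro u
    rw [sum_support_T]
    simp only [if_true, (D.refl_ne_one i).symm, if_false]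
    rw [refl_inv, inv_one, mul_one]
    exact (D.symmetrizer_right (hc u).1 (hb u).1).symm

end AffineDatum

/-! ### Termwise action and regular rational functions -/

namespace AffineDatum

variable {I : Type*} [Fintype I] [DecidableEq I] {D : AffineDatum I}

/-- `g` is obtained from `f` by moving the coefficient of `e^γ` to `e^{wγ}`. -/
def Permuted (w : D.weylGroup) (f g : CorootSeries I) : Prop :=
  ∀ γ : I → ℤ, g.coeff (OrderDual.toDual (w.1 γ)) = f.coeff (OrderDual.toDual γ)

namespace Permuted

variable {w : D.weylGroup} {f g f' g' : CorootSeries I}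

theorem eq (h : Permuted w f g) (h' : Permuted w f g') : g = g' := by
  ext x : 2
  obtain ⟨γ, rfl⟩ := OrderDual.toDual.surjective x
  rw [← D.apply_inv_apply w γ, h, h']

theorem symm (h : Permuted w f g) : Permuted w⁻¹ g f := by
  intro γ
  rw [← h, apply_inv_apply]

theorem trans {w' : D.weylGroup} (h : Permuted w f g) (h' : Permuted w' g g') :
    Permuted (w' * w) f g' := by
  intro γ
  rw [mul_apply, h', h]

theorem one : Permuted w 1 1 := by
  intro γ
  rw [HahnSeries.coeff_one, HahnSeries.coeff_one]
  have : OrderDual.toDual (w.1 γ) = 0 ↔ OrderDual.toDual γ = 0 :=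
    map_eq_zero_iff w.1 w.1.injective
  by_cases h : OrderDual.toDual γ = 0
  · rw [if_pos (this.mpr h), if_pos h]
  · rw [if_neg (fun h' => h (this.mp h')), if_neg h]

theorem add (h : Permuted w f g) (h' : Permuted w f' g') : Permuted w (f + f') (g + g') := by
  intro γ
  rw [HahnSeries.coeff_add, HahnSeries.coeff_add, h, h']

theorem mul (h : Permuted w f g) (h' : Permuted w f' g') : Permuted w (f * f') (g * g') := by
  intro γ
  rw [HahnSeries.coeff_mul, HahnSeries.coeff_mul]
  symm
  have hadd : ∀ x y : (I → ℤ)ᵒᵈ, OrderDual.toDual (w.1 (OrderDual.ofDual x)) +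
      OrderDual.toDual (w.1 (OrderDual.ofDual y)) =
      OrderDual.toDual (w.1 (OrderDual.ofDual (x + y))) := by
    intro x y
    change OrderDual.toDual (w.1 (OrderDual.ofDual x) + w.1 (OrderDual.ofDual y)) = _
    rw [← map_add]; rfl
  have hinv : ∀ x : (I → ℤ)ᵒᵈ, ∀ k k' : CorootSeries I, Permuted w k k' →
      k.coeff (OrderDual.toDual (w⁻¹.1 (OrderDual.ofDual x))) = k'.coeff x := by
    intro x k k' hk
    rw [← hk, apply_inv_apply]; rfl
  refine Finset.sum_nbij'
    (fun p => (OrderDual.toDual (w.1 (OrderDual.ofDual p.1)),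
      OrderDual.toDual (w.1 (OrderDual.ofDual p.2))))
    (fun p => (OrderDual.toDual (w⁻¹.1 (OrderDual.ofDual p.1)),
      OrderDual.toDual (w⁻¹.1 (OrderDual.ofDual p.2)))) ?_ ?_ ?_ ?_ ?_
  · intro p hp
    rw [Finset.mem_antidiagonal] at hp ⊢
    refine ⟨?_, ?_, ?_⟩
    · rw [HahnSeries.mem_support, h]; exact hp.1
    · rw [HahnSeries.mem_support, h']; exact hp.2.1
    · rw [hadd, hp.2.2]; rfl
  · intro p hp
    rw [Finset.mem_antidiagonal] at hp ⊢
    refine ⟨?_, ?_, ?_⟩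
    · rw [HahnSeries.mem_support, hinv _ _ _ h]; exact hp.1
    · rw [HahnSeries.mem_support, hinv _ _ _ h']; exact hp.2.1
    · have : OrderDual.ofDual p.1 + OrderDual.ofDual p.2 = w.1 γ :=
        congrArg OrderDual.ofDual hp.2.2
      change OrderDual.toDual (w⁻¹.1 (OrderDual.ofDual p.1) + w⁻¹.1 (OrderDual.ofDual p.2)) = _
      rw [← map_add, this, inv_apply_apply]
  · intro p _
    simp
  · intro p _
    simp
  · intro p _
    rw [h, h']; rfl

theorem toSeries (w : D.weylGroup) (d : CorootAlg I) :
    Permuted w (toSeries I d) (toSeries I (w • d)) := by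
  intro γ
  rw [coeff_toSeries, coeff_toSeries, coeff_smul_apply]

/-- Termwise application of `w` is compatible with inverses, provided these exist on both sides. -/
theorem inverse {N N' M M' : CorootSeries I} (h : Permuted w N N') (hN : SupportedBelow 0 N)
    (hN' : SupportedBelow 0 N') (h0 : N.coeff 0 = 1) (hM : SupportedBelow 0 M)
    (h1 : N * M = 1) (h1' : N' * M' = 1) : Permuted w M M' := by
  -- The exponents of `M` are sums of exponents of `N`, whose `w`-images are ≤ 0 because they are
  -- exponents of N'. So moving the coefficients of `M` by `w` gives a legitimate series, which must
  -- be the inverse of N'.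
  have key : ∀ (n : ℕ) (γ : I → ℤ), height I (-γ) ≤ n → M.coeff (OrderDual.toDual γ) ≠ 0 →
      w.1 γ ≤ 0 := by
    intro n
    induction n using Nat.strong_induction_on with
    | _ n ih =>
    intro γ hn hγ
    by_cases hγ0 : γ = 0
    · simp [hγ0]
    have h2 : (N - 1) * M = 1 - M := by linear_combination h1
    have h3 : ((N - 1) * M).coeff (OrderDual.toDual γ) ≠ 0 := by
      rw [h2, HahnSeries.coeff_sub, HahnSeries.coeff_one, if_neg (show OrderDual.toDual γ ≠ 0 from hγ0)]
      simpa using hγ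
    obtain ⟨α, β, hα, hβ, rfl⟩ := exists_coeff_ne_zero_of_mul h3
    have hα0 : α ≠ 0 := by
      rintro rfl
      apply hα
      rw [HahnSeries.coeff_sub, HahnSeries.coeff_one,
        if_pos (show OrderDual.toDual (0 : I → ℤ) = 0 from rfl)]
      change N.coeff 0 - 1 = 0
      rw [h0, sub_self]
    have hα1 : N.coeff (OrderDual.toDual α) ≠ 0 := by
      rw [HahnSeries.coeff_sub, HahnSeries.coeff_one,
        if_neg (show OrderDual.toDual α ≠ 0 from hα0), sub_zero] at hα
      exact hα
    have hα2 : w.1 α ≤ 0 := hN' _ (by rwa [h])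
    have hα3 : 0 < height I (-α) :=
      height_pos (by simpa using hN α hα1) (neg_ne_zero.mpr hα0)
    have hβ2 := height_nonneg (x := -β) (by simpa using hM β hβ)
    have hsum : height I (-(α + β)) = height I (-α) + height I (-β) := by
      rw [neg_add, map_add]
    have := ih (height I (-β)).toNat (by omega) β (Int.self_le_toNat _) hβ
    rw [map_add]
    exact add_nonpos hα2 this
  let M'' : CorootSeries I :=
    { coeff := fun x => M.coeff (OrderDual.toDual (w⁻¹.1 (OrderDual.ofDual x)))
      isPWO_support' := isPWO_Iic_zero.mono (fun x hx => by
        have := key _ _ (Int.self_le_toNat _) hx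
        rwa [apply_inv_apply] at this) }
  have hM'' : Permuted w M M'' := by
    intro γ
    change M.coeff (OrderDual.toDual (w⁻¹.1 (w.1 γ))) = _
    rw [inv_apply_apply]
  have h3 : N' * M'' = 1 := by
    have := h.mul hM''
    rw [h1] at this
    exact this.eq one
  have h4 : M'' = M' := by linear_combination M' * h3 - M'' * h1'
  rwa [← h4]

end Permuted

/-- `r` and `w_i r` have expansions which correspond to each other termwise. -/
def Regular (D : AffineDatum I) (i : I) (r : RatFun I) : Prop :=
  ∃ f g, IsExpansion r f ∧ IsExpansion (D.refl i • r) g ∧ Permuted (D.refl i) f g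

namespace Regular

variable {i : I} {r s : RatFun I}

theorem add (h : D.Regular i r) (h' : D.Regular i s) : D.Regular i (r + s) := by
  obtain ⟨f, g, h1, h2, h3⟩ := h
  obtain ⟨f', g', h1', h2', h3'⟩ := h'
  exact ⟨f + f', g + g', h1.add h1', by rw [smul_add]; exact h2.add h2', h3.add h3'⟩

theorem mul (h : D.Regular i r) (h' : D.Regular i s) : D.Regular i (r * s) := by
  obtain ⟨f, g, h1, h2, h3⟩ := h
  obtain ⟨f', g', h1', h2', h3'⟩ := h'
  exact ⟨f * f', g * g', h1.mul h1', by rw [smul_mul']; exact h2.mul h2', h3.mul h3'⟩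

theorem alg (d : CorootAlg I) : D.Regular i (algebraMap (CorootAlg I) (RatFun I) d) :=
  ⟨_, _, IsExpansion.of_alg d, by rw [smul_algebraMap]; exact IsExpansion.of_alg _,
    Permuted.toSeries _ d⟩

theorem expR (γ : I → ℤ) : D.Regular i (expR γ) := alg (expA γ)

theorem vInvR : D.Regular i (vInvR I) := alg (vInvA I)

theorem zero : D.Regular i 0 := by simpa using alg (D := D) (i := i) 0

theorem one : D.Regular i 1 := by simpa using alg (D := D) (i := i) 1

theorem neg (h : D.Regular i r) : D.Regular i (-r) := by
  have := (alg (D := D) (i := i) (-1)).mul h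
  simpa only [map_neg, map_one, neg_one_mul] using this

theorem sub (h : D.Regular i r) (h' : D.Regular i s) : D.Regular i (r - s) := by
  rw [sub_eq_add_neg]; exact h.add h'.neg

theorem refl_smul (h : D.Regular i r) : D.Regular i (D.refl i • r) := by
  obtain ⟨f, g, h1, h2, h3⟩ := h
  refine ⟨g, f, h2, ?_, ?_⟩
  · rw [smul_smul, refl_mul_self, one_smul]; exact h1
  · have := h3.symm
    rwa [refl_inv] at this

/-- For β ≠ ±a_i^∨ the reflection preserves the sign of `β`, so 1/(1 - e^β) and its image are
expanded in the same direction. For ±a_i^∨ the directions differ, and this is the only obstruction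
to applying w_i termwise. -/
theorem inv_one_sub {β : I → ℤ} (hβ : D.IsRealCoroot β) (h1 : β ≠ D.simpleCoroot i)
    (h2 : β ≠ -D.simpleCoroot i) : D.Regular i (1 - _root_.expR β)⁻¹ := by
  have key : ∀ β : I → ℤ, D.IsRealCoroot β → 0 ≤ β → β ≠ D.simpleCoroot i →
      D.Regular i (1 - _root_.expR (-β))⁻¹ := by
    intro β hβ h0 h1
    obtain ⟨g, hg, hg1⟩ := exists_geometric h0 hβ.ne_zero
    have h0' := hβ.refl_nonneg h0 h1
    obtain ⟨g', hg', hg1'⟩ := exists_geometric h0' (hβ.apply _).ne_zero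
    have hs : D.refl i • (1 - expA (-β)) = 1 - expA (-(D.refl i).1 β) := by
      rw [smul_sub, smul_one, smul_expA, map_neg]
    have e1 := IsExpansion.inv_alg hg1
    have e2 := IsExpansion.inv_alg hg1'
    have hsup : ∀ δ : I → ℤ, 0 ≤ δ → SupportedBelow 0 (_root_.toSeries I (1 - expA (-δ))) := by
      intro δ hδ
      rw [map_sub, map_one, toSeries_expA]
      exact SupportedBelow.one.sub ((SupportedBelow.expS _).mono (by simpa using hδ))
    have hp := Permuted.toSeries (D.refl i) (1 - expA (-β))
    rw [hs] at hp
    refine ⟨g, g', by simpa [algebraMap_expA] using e1, ?_, ?_⟩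
    · have : D.refl i • (1 - _root_.expR (-β))⁻¹ =
          (algebraMap (CorootAlg I) (RatFun I) (1 - expA (-(D.refl i).1 β)))⁻¹ := by
        rw [← one_div, smul_div, smul_one, one_div, ← hs, ← smul_algebraMap, map_sub, map_one,
          algebraMap_expA]
      rw [this]; exact e2
    · refine hp.inverse (hsup _ h0) (hsup _ h0') ?_ hg hg1 hg1'
      change (_root_.toSeries I (1 - expA (-β))).coeff (OrderDual.toDual 0) = 1
      rw [coeff_toSeries]
      simp [expA, AddMonoidAlgebra.one_def, hβ.ne_zero]
  rcases hβ.nonneg_or_nonpos with h0 | h0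
  · have e : (1 - _root_.expR β)⁻¹ = -(_root_.expR (-β) * (1 - _root_.expR (-β))⁻¹) := by
      have h2 := expR_ne_zero β
      have h3 := one_sub_expR_ne_zero hβ.ne_zero
      rw [expR_neg, one_sub_expR_inv]
      field_simp
    rw [e]
    exact ((expR _).mul (key β hβ h0 h1)).neg
  · have := key (-β) hβ.neg (by simpa using h0) (fun h => h2 (by rw [← h, neg_neg]))
    rwa [neg_neg] at this

end Regular

/-- `r` is regular, and congruent to `w_i r` modulo `1 - e^{a_i}`. -/
def StronglyRegular (D : AffineDatum I) (i : I) (r : RatFun I) : Prop :=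
  D.Regular i r ∧ D.Regular i ((r - D.refl i • r) / (1 - expR (D.simpleCoroot i)))

namespace StronglyRegular

variable {i : I} {r s : RatFun I}

theorem sub (h : D.StronglyRegular i r) (h' : D.StronglyRegular i s) :
    D.StronglyRegular i (r - s) := by
  refine ⟨h.1.sub h'.1, ?_⟩
  have := h.2.sub h'.2
  rw [← sub_div] at this
  rw [smul_sub]
  convert this using 2
  ring

theorem mul (h : D.StronglyRegular i r) (h' : D.StronglyRegular i s) :
    D.StronglyRegular i (r * s) := by
  refine ⟨h.1.mul h'.1, ?_⟩
  have := (h.2.mul h'.1).add (h.1.refl_smul.mul h'.2)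
  rw [smul_mul']
  convert this using 1
  ring

theorem of_smul_eq (h : D.Regular i r) (h' : D.refl i • r = r) : D.StronglyRegular i r :=
  ⟨h, by rw [h', sub_self, zero_div]; exact Regular.zero⟩

theorem one : D.StronglyRegular i 1 := of_smul_eq Regular.one (smul_one _)

theorem vInvR : D.StronglyRegular i (vInvR I) := of_smul_eq Regular.vInvR (D.smul_vInvR _)

/-- The reflection moves `γ` by a multiple of a_i^∨, so the quotient is e^γ times a finite geometric
sum, up to a unit. -/
theorem expR (γ : I → ℤ) : D.StronglyRegular i (expR γ) := by
  refine ⟨Regular.expR γ, ?_⟩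
  set a := D.simpleCoroot i
  have hpow : ∀ n : ℕ, expA (n • a) = expA a ^ n := by
    intro n
    induction n with
    | zero => rw [zero_smul, pow_zero, expA_zero]
    | succ n ih => rw [succ_nsmul, ← expA_mul_expA, ih, pow_succ]
  have key : ∀ n : ℕ, ∃ p, 1 - expA (n • a) = (1 - expA a) * p := by
    intro n
    obtain ⟨p, hp⟩ := sub_dvd_pow_sub_pow (1 : CorootAlg I) (expA a) n
    exact ⟨p, by rw [← hp, one_pow, hpow]⟩
  have key2 : ∀ n : ℤ, ∃ p, 1 - expA (n • a) = (1 - expA a) * p := by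
    intro n
    obtain ⟨m, rfl | rfl⟩ := n.eq_nat_or_neg
    · obtain ⟨p, hp⟩ := key m
      exact ⟨p, by rw [← hp, natCast_zsmul]⟩
    · obtain ⟨p, hp⟩ := key m
      refine ⟨-expA (-(m • a)) * p, ?_⟩
      have : expA (-(m • a)) * expA (m • a) = 1 := by
        rw [expA_mul_expA, neg_add_cancel, expA_zero]
      rw [neg_smul, natCast_zsmul]
      linear_combination -expA (-(m • a)) * hp - this
  obtain ⟨p, hp⟩ := key2 (-D.form a γ)
  have h0 := one_sub_expR_ne_zero (IsRealCoroot.simple (D := D) i).ne_zero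
  have : (_root_.expR γ - D.refl i • _root_.expR γ) / (1 - _root_.expR a) =
      algebraMap (CorootAlg I) (RatFun I) (expA γ * p) := by
    rw [div_eq_iff h0, smul_expR, refl_apply,
      show γ - D.form a γ • a = γ + (-D.form a γ) • a by module, expR_add]
    have := congrArg (algebraMap (CorootAlg I) (RatFun I)) hp
    rw [map_sub, map_mul, map_sub, map_one, algebraMap_expA, algebraMap_expA] at this
    rw [map_mul, algebraMap_expA]
    linear_combination _root_.expR γ * this
  rw [this]
  exact Regular.alg _

theorem inv (h : D.StronglyRegular i r) (h' : D.Regular i r⁻¹) (h0 : r ≠ 0) :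
    D.StronglyRegular i r⁻¹ := by
  refine ⟨h', ?_⟩
  have e : D.refl i • r⁻¹ = (D.refl i • r)⁻¹ := by
    rw [← one_div, smul_div, smul_one, one_div]
  have h1 : D.refl i • r ≠ 0 := (smul_ne_zero_iff_ne _).mpr h0
  have := ((h.2.mul h').mul h'.refl_smul).neg
  rw [e] at this ⊢
  convert this using 1
  rw [div_eq_mul_inv, div_eq_mul_inv]
  field_simp
  ring

theorem inv_one_sub {β : I → ℤ} (hβ : D.IsRealCoroot β) (h1 : β ≠ D.simpleCoroot i)
    (h2 : β ≠ -D.simpleCoroot i) : D.StronglyRegular i (1 - _root_.expR β)⁻¹ :=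
  (one.sub (expR β)).inv (Regular.inv_one_sub hβ h1 h2) (one_sub_expR_ne_zero hβ.ne_zero)

theorem cFun {β : I → ℤ} (hβ : D.IsRealCoroot β) (h1 : β ≠ D.simpleCoroot i)
    (h2 : β ≠ -D.simpleCoroot i) : D.StronglyRegular i (cFun β) := by
  rw [_root_.cFun, div_eq_mul_inv]
  exact (one.sub (vInvR.mul (expR _))).mul (inv_one_sub hβ h1 h2)

theorem bFun {β : I → ℤ} (hβ : D.IsRealCoroot β) (h1 : β ≠ D.simpleCoroot i)
    (h2 : β ≠ -D.simpleCoroot i) : D.StronglyRegular i (bFun β) := by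
  rw [_root_.bFun, div_eq_mul_inv]
  exact (vInvR.sub one).mul (inv_one_sub hβ h1 h2)

end StronglyRegular

/-! ### Simple poles with opposite residues -/

/-- Elements of `R[W]` with simple poles along `e^{a_i} = 1` and opposite residues at `u`, `w_i u`. -/
def HasOppositeResidues (i : I) (F : D.RW) : Prop :=
  ∀ u, D.Regular i ((1 - expR (D.simpleCoroot i)) * F.coeff u) ∧
    D.Regular i (F.coeff u + F.coeff (D.refl i * u))

/-- This is the case u a_j^∨ = ±a_i^∨, where T_j mixes the coefficients `P`, `R` at a pair u, w_i u
and contributes another factor with a pole along e^{a_i^∨} = 1. Regularity of P + R prevents a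
double pole, and the new pair again has opposite residues. -/
theorem regular_step {i : I} {P R : RatFun I} {a : I → ℤ} (ha : a = D.simpleCoroot i)
    (hP : D.Regular i ((1 - expR a) * P))
    (hR : D.Regular i ((1 - expR a) * R)) (hPR : D.Regular i (P + R)) :
    D.Regular i ((1 - expR a) * (R * cFun (-a) + P * bFun a)) ∧
    D.Regular i ((1 - expR a) * (P * cFun a + R * bFun (-a))) ∧
    D.Regular i ((R * cFun (-a) + P * bFun a) + (P * cFun a + R * bFun (-a))) := by
  have h0 : a ≠ 0 := by rw [ha]; exact (IsRealCoroot.simple (D := D) i).ne_zero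
  have h1 := expR_ne_zero a
  have h2 := one_sub_expR_ne_zero h0
  have hx : D.Regular i (expR a) := Regular.expR a
  have hy : D.Regular i (expR (-a)) := Regular.expR (-a)
  have hq : D.Regular i (vInvR I) := Regular.vInvR
  have h1' : D.Regular i 1 := Regular.one
  refine ⟨?_, ?_, ?_⟩
  · have e : (1 - expR a) * (R * cFun (-a) + P * bFun a) =
        -(expR a * (1 - vInvR I * expR a)) * (P + R) -
          ((1 - expR a) * P) * (1 - vInvR I - vInvR I * expR a) := by
      rw [cFun_neg_eq h0, bFun]
      field_simp
      ring
    rw [e]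
    exact ((hx.mul (h1'.sub (hq.mul hx))).neg.mul hPR).sub
      (hP.mul ((h1'.sub hq).sub (hq.mul hx)))
  · have e : (1 - expR a) * (P * cFun a + R * bFun (-a)) =
        (1 - vInvR I * expR (-a)) * (P + R) +
          ((1 - expR a) * R) * ((vInvR I - 1) + vInvR I * expR (-a)) := by
      rw [cFun_eq h0, bFun_neg_eq h0, expR_neg]
      field_simp
      ring
    rw [e]
    exact ((h1'.sub (hq.mul hy)).mul hPR).add (hR.mul ((hq.sub h1').add (hq.mul hy)))
  · have e : (R * cFun (-a) + P * bFun a) + (P * cFun a + R * bFun (-a)) =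
        -(vInvR I * expR (-a)) * (P + R) +
          ((1 - expR a) * R) * (vInvR I * (1 + expR a) * expR (-a)) := by
      rw [cFun_eq h0, cFun_neg_eq h0, bFun_neg_eq h0, bFun, expR_neg]
      field_simp
      ring
    rw [e]
    exact ((hq.mul hy).neg.mul hPR).add (hR.mul ((hq.mul (h1'.add hx)).mul hy))

/-- Either u a_j^∨ = ±a_i^∨, which is `regular_step`, or the new factors have no pole along
e^{a_i^∨} = 1. In the latter case the factors at u and w_i u are exchanged by w_i and agree modulo 1
- e^{a_i^∨}, so the residues stay opposite. -/
theorem HasOppositeResidues.mul_T {i : I} {F : D.RW} (hF : HasOppositeResidues i F) (j : I) :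
    HasOppositeResidues i (F * D.T j) := by
  intro u
  set a := D.simpleCoroot i with ha
  have hr := (IsRealCoroot.simple (D := D) j).apply u
  by_cases h1 : u.1 (D.simpleCoroot j) = a
  · have hu := D.mul_refl_eq_refl_mul (Or.inl h1)
    have hu' : D.refl i * u * D.refl j = u := by rw [← hu, mul_refl_mul_refl]
    obtain ⟨s1, s2, s3⟩ := regular_step ha (hF u).1 (hF (D.refl i * u)).1 (hF u).2
    have e1 : (F * D.T j).coeff u =
        F.coeff (D.refl i * u) * cFun (-a) + F.coeff u * bFun a := by
      rw [coeff_mul_T, hu, h1]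
    have e2 : (F * D.T j).coeff (D.refl i * u) =
        F.coeff u * cFun a + F.coeff (D.refl i * u) * bFun (-a) := by
      rw [coeff_mul_T, hu', mul_apply, h1, ha, refl_simpleCoroot, neg_neg]
    rw [e1, e2]
    exact ⟨s1, s3⟩
  by_cases h2 : u.1 (D.simpleCoroot j) = -a
  · have hu := D.mul_refl_eq_refl_mul (Or.inr h2)
    have hu' : D.refl i * u * D.refl j = u := by rw [← hu, mul_refl_mul_refl]
    have hPR := (hF u).2
    rw [add_comm] at hPR
    obtain ⟨s1, s2, s3⟩ := regular_step ha (hF (D.refl i * u)).1 (hF u).1 hPR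
    have e1 : (F * D.T j).coeff u =
        F.coeff (D.refl i * u) * cFun a + F.coeff u * bFun (-a) := by
      rw [coeff_mul_T, hu, h2, neg_neg]
    have e2 : (F * D.T j).coeff (D.refl i * u) =
        F.coeff u * cFun (-a) + F.coeff (D.refl i * u) * bFun a := by
      rw [coeff_mul_T, hu', mul_apply, h2, map_neg, ha, refl_simpleCoroot]
      simp only [neg_neg]
    rw [e1, e2]
    rw [add_comm] at s3
    exact ⟨s2, s3⟩
  have hc := StronglyRegular.cFun hr.neg (i := i) (fun h => h2 (by rw [ha, ← h, neg_neg]))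
    (fun h => h1 (neg_injective h))
  have hb := StronglyRegular.bFun hr (i := i) h1 h2
  constructor
  · rw [coeff_mul_T, mul_add, ← mul_assoc, ← mul_assoc]
    exact ((hF _).1.mul hc.1).add ((hF _).1.mul hb.1)
  · have h0 := one_sub_expR_ne_zero (IsRealCoroot.simple (D := D) i).ne_zero
    -- For opposite residues P, R and a factor r: P r + R (w_i r) = (P + R) r - (1 - e^{a_i^∨})R ·
    -- (r - w_i r)/(1 - e^{a_i^∨}).
    have t := (((hF (u * D.refl j)).2.mul hc.1).sub
      ((hF (D.refl i * (u * D.refl j))).1.mul hc.2)).add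
      (((hF u).2.mul hb.1).sub ((hF (D.refl i * u)).1.mul hb.2))
    rw [smul_cFun, smul_bFun, map_neg] at t
    rw [coeff_mul_T, coeff_mul_T, mul_apply, mul_assoc]
    convert t using 1
    field_simp
    ring

variable (D) in
theorem hasOppositeResidues_heckeBasis (i : I) (w : D.weylGroup) :
    HasOppositeResidues i (D.heckeBasis w) := by
  rw [heckeBasis]
  induction (D.exists_reduced w).choose using List.reverseRecOn with
  | nil =>
    intro u
    have h : ∀ u : D.weylGroup, D.Regular i ((1 : D.RW).coeff u) := by
      classical
      intro u
      rw [SkewMonoidAlgebra.coeff_one, Finsupp.single_apply]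
      split_ifs
      · exact Regular.one
      · exact Regular.zero
    rw [List.map_nil, List.prod_nil]
    exact ⟨(Regular.one.sub (Regular.expR _)).mul (h _), (h _).add (h _)⟩
  | append_singleton l j ih =>
    rw [List.map_append, List.prod_append, List.map_singleton, List.prod_singleton]
    exact ih.mul_T j

end AffineDatum

/-! ### The action of simple reflections and the left eigenvalue equation -/

theorem toSeries_one_sub_vInvA_mul_expA {I : Type*} (γ : I → ℤ) :
    toSeries I (1 - vInvA I * expA γ) = 1 - vInvS I * expS γ := by
  rw [map_sub, map_one, map_mul, toSeries_vInvA, toSeries_expA]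

theorem supportedBelow_one_sub_vInvS_mul_expS {I : Type*} {γ : I → ℤ} (h : 0 ≤ γ) :
    SupportedBelow 0 (1 - vInvS I * expS (-γ)) := by
  have := SupportedBelow.vInvS.mul (SupportedBelow.expS (-γ))
  exact SupportedBelow.one.sub (this.mono (by simpa using h))

theorem coeff_zero_one_sub_vInvS_mul_expS {I : Type*} {γ : I → ℤ} (h : γ ≠ 0) :
    (1 - vInvS I * expS (-γ)).coeff 0 = 1 := by
  rw [← toSeries_one_sub_vInvA_mul_expA]
  change (toSeries I _).coeff (OrderDual.toDual 0) = 1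
  rw [coeff_toSeries]
  simp [vInvA, expA, AddMonoidAlgebra.one_def, AddMonoidAlgebra.single_mul_single, h]

namespace AffineDatum

variable {I : Type*} [Fintype I] [DecidableEq I] (D : AffineDatum I)

/-- With X = T_w + T_{w_i w}, the relation T_i X = v⁻¹X read at [u] is 𝐜(a) w_i(X_{w_i u}) + 𝐛(a)
X_u = v⁻¹X_u; clearing 1 - e^a gives the identity. -/
theorem smul_coeff_heckeBasis_add (i : I) (u w : D.weylGroup) :
    (1 - vInvR I * expR (-D.simpleCoroot i)) *
        D.refl i • (D.heckeBasis w + D.heckeBasis (D.refl i * w)).coeff (D.refl i * u) =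
      (1 - vInvR I * expR (D.simpleCoroot i)) *
        (D.heckeBasis w + D.heckeBasis (D.refl i * w)).coeff u := by
  have h0 := one_sub_expR_ne_zero (IsRealCoroot.simple (D := D) i).ne_zero
  have key : ∀ w : D.weylGroup, 0 ≤ w⁻¹.1 (D.simpleCoroot i) →
      (1 - vInvR I * expR (-D.simpleCoroot i)) *
        D.refl i • (D.heckeBasis w + D.heckeBasis (D.refl i * w)).coeff (D.refl i * u) =
      (1 - vInvR I * expR (D.simpleCoroot i)) *
        (D.heckeBasis w + D.heckeBasis (D.refl i * w)).coeff u := by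
    intro w h
    have h1 := D.heckeBasis_refl_mul h
    have e1 := D.coeff_T_mul (D.heckeBasis w + D.heckeBasis (D.refl i * w)) i u
    have e2 : (D.T i * (D.heckeBasis w + D.heckeBasis (D.refl i * w))).coeff u =
        vInvR I * (D.heckeBasis w + D.heckeBasis (D.refl i * w)).coeff u := by
      rw [mul_add, ← h1, SkewMonoidAlgebra.coeff_add, Finsupp.add_apply, h1, coeff_T_mul_T_mul,
        SkewMonoidAlgebra.coeff_add, Finsupp.add_apply]
      ring
    rw [e2, cFun, bFun] at e1
    field_simp at e1
    linear_combination -e1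
  rcases ((IsRealCoroot.simple (D := D) i).apply w⁻¹).nonneg_or_nonpos with h | h
  · exact key w h
  · have := key (D.refl i * w) (by
      rw [mul_inv_rev, refl_inv, mul_apply, refl_simpleCoroot, map_neg]; simpa using h)
    rwa [refl_mul_refl_mul, add_comm (D.heckeBasis _)] at this

/-- The factor 1 - e^a removes the simple pole, so w_i may be applied termwise to the expansion. The
factor 1 - v⁻¹e^a becomes, after w_i, the left-hand factor of `smul_coeff_heckeBasis_add`. Neither
depends on w, as summation over w requires. -/
theorem coeff_heckeCoeff_add (i : I) (u w : D.weylGroup) (γ : I → ℤ) :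
    (toSeries I ((1 - expA (D.simpleCoroot i)) * (1 - vInvA I * expA (D.simpleCoroot i))) *
        (D.heckeCoeff (D.refl i * u) w + D.heckeCoeff (D.refl i * u) (D.refl i * w))).coeff
        (OrderDual.toDual γ) =
      (toSeries I ((1 - expA (-D.simpleCoroot i)) * (1 - vInvA I * expA (D.simpleCoroot i))) *
        (D.heckeCoeff u w + D.heckeCoeff u (D.refl i * w))).coeff
        (OrderDual.toDual ((D.refl i).1 γ)) := by
  set a := D.simpleCoroot i
  have hsum := D.smul_coeff_heckeBasis_add i u w
  have h1 := (D.hasOppositeResidues_heckeBasis i w (D.refl i * u)).1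
  have h2 := (D.hasOppositeResidues_heckeBasis i (D.refl i * w) (D.refl i * u)).1
  have h3 := (h1.add h2).mul (Regular.one.sub (Regular.vInvR.mul (Regular.expR a)))
  obtain ⟨f, g, hf, hg, hfg⟩ := h3
  have hd : ∀ γ : I → ℤ, IsExpansion ((1 - expR γ) * (1 - vInvR I * expR a))
      (toSeries I ((1 - expA γ) * (1 - vInvA I * expA a))) := by
    intro γ
    have := IsExpansion.of_alg ((1 - expA γ) * (1 - vInvA I * expA a))
    rwa [map_mul (algebraMap _ _), map_sub, map_sub, map_mul, map_one] at this
  have ef : f = toSeries I ((1 - expA a) * (1 - vInvA I * expA a)) *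
      (D.heckeCoeff (D.refl i * u) w + D.heckeCoeff (D.refl i * u) (D.refl i * w)) := by
    refine hf.unique ?_
    have := (hd a).mul ((D.heckeCoeff_isExpansion (D.refl i * u) w).add
      (D.heckeCoeff_isExpansion (D.refl i * u) (D.refl i * w)))
    convert this using 1
    ring
  have eg : g = toSeries I ((1 - expA (-a)) * (1 - vInvA I * expA a)) *
      (D.heckeCoeff u w + D.heckeCoeff u (D.refl i * w)) := by
    refine hg.unique ?_
    have := (hd (-a)).mul ((D.heckeCoeff_isExpansion u w).add
      (D.heckeCoeff_isExpansion u (D.refl i * w)))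
    convert this using 1
    rw [SkewMonoidAlgebra.coeff_add, Finsupp.add_apply, Finsupp.add_apply] at hsum
    simp only [smul_mul', smul_add, smul_sub, smul_one, smul_expR, smul_vInvR, a,
      refl_simpleCoroot] at hsum ⊢
    linear_combination (1 - expR (-D.simpleCoroot i)) * hsum
  rw [← ef, ← eg, hfg]

/-- Termwise application of `w_i` to the symmetrizer, with denominators cleared. -/
theorem permuted_symmetrizer (i : I) (u : D.weylGroup) :
    Permuted (D.refl i)
      (toSeries I ((1 - expA (D.simpleCoroot i)) * (1 - vInvA I * expA (D.simpleCoroot i))) *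
        D.symmetrizer (D.refl i * u))
      (toSeries I ((1 - expA (-D.simpleCoroot i)) * (1 - vInvA I * expA (D.simpleCoroot i))) *
        D.symmetrizer u) := by
  intro γ
  rw [coeff_mul_symmetrizer, coeff_mul_symmetrizer, ← sub_eq_zero,
    ← finsum_sub_distrib (D.finite_mul_heckeCoeff _ _ _) (D.finite_mul_heckeCoeff _ _ _)]
  refine finsum_eq_zero_of_add_apply_eq_zero _ (Equiv.mulLeft (D.refl i)) ?_ fun w => ?_
  · exact (D.finite_mul_heckeCoeff _ _ _).sub (D.finite_mul_heckeCoeff _ _ _)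
  · have := D.coeff_heckeCoeff_add i u w γ
    simp only [mul_add, HahnSeries.coeff_add] at this
    simp only [Equiv.coe_mulLeft]
    linear_combination -this

theorem exists_inverse_one_sub_vInvS_mul_expS (i : I) :
    ∃ g, SupportedBelow 0 g ∧ (1 - vInvS I * expS (-D.simpleCoroot i)) * g = 1 :=
  (supportedBelow_one_sub_vInvS_mul_expS (D.simpleCoroot_nonneg i)).exists_inverse
    (coeff_zero_one_sub_vInvS_mul_expS (IsRealCoroot.simple (D := D) i).ne_zero)

theorem isTransform_one (f : CorootSeries I) : D.IsTransform 1 f f :=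
  ⟨1, one_ne_zero, fun γ => by rw [one_smul]; rfl⟩

theorem smul_denominator (i : I) :
    D.refl i • ((1 - expA (D.simpleCoroot i)) * (1 - vInvA I * expA (D.simpleCoroot i))) =
      (1 - expA (-D.simpleCoroot i)) * (1 - vInvA I * expA (-D.simpleCoroot i)) := by
  simp only [smul_mul', smul_sub, smul_one, smul_expA, smul_vInvA, refl_simpleCoroot]

theorem isTransform_symmetrizer {i : I} {ρ : CorootSeries I}
    (hρ : (1 - vInvS I * expS (-D.simpleCoroot i)) * ρ = 1 - vInvS I * expS (D.simpleCoroot i))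
    (u : D.weylGroup) :
    D.IsTransform (D.refl i) (D.symmetrizer (D.refl i * u)) (ρ * D.symmetrizer u) := by
  refine ⟨(1 - expA (D.simpleCoroot i)) * (1 - vInvA I * expA (D.simpleCoroot i)),
    mul_ne_zero (one_sub_expA_ne_zero (IsRealCoroot.simple (D := D) i).ne_zero)
      (one_sub_vInvA_mul_expA_ne_zero _), fun γ => ?_⟩
  rw [← D.permuted_symmetrizer i u γ, smul_denominator, map_mul, map_mul,
    toSeries_one_sub_vInvA_mul_expA, toSeries_one_sub_vInvA_mul_expA]
  refine congrArg (fun f : CorootSeries I => f.coeff (OrderDual.toDual ((D.refl i).1 γ))) ?_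
  linear_combination toSeries I (1 - expA (-D.simpleCoroot i)) * D.symmetrizer u * hρ

theorem isExpansion_ratio {i : I} {ρ : CorootSeries I}
    (hρ : (1 - vInvS I * expS (-D.simpleCoroot i)) * ρ = 1 - vInvS I * expS (D.simpleCoroot i)) :
    IsExpansion ((1 - vInvR I * expR (D.simpleCoroot i)) /
      (1 - vInvR I * expR (-D.simpleCoroot i))) ρ := by
  have h := one_sub_vInvR_mul_expR_ne_zero (-D.simpleCoroot i)
  refine ⟨1 - vInvA I * expA (D.simpleCoroot i), 1 - vInvA I * expA (-D.simpleCoroot i),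
    one_sub_vInvA_mul_expA_ne_zero _, ?_, ?_⟩
  · simp only [map_sub, map_mul, map_one, algebraMap_expA, algebraMap_vInvA]
    exact div_mul_cancel₀ _ h
  · rw [toSeries_one_sub_vInvA_mul_expA, toSeries_one_sub_vInvA_mul_expA, mul_comm, hρ]

theorem exists_ratio (i : I) : ∃ ρ : CorootSeries I,
    (1 - vInvS I * expS (-D.simpleCoroot i)) * ρ = 1 - vInvS I * expS (D.simpleCoroot i) := by
  obtain ⟨g, -, hg⟩ := D.exists_inverse_one_sub_vInvS_mul_expS i
  exact ⟨(1 - vInvS I * expS (D.simpleCoroot i)) * g, by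
    linear_combination (1 - vInvS I * expS (D.simpleCoroot i)) * hg⟩

/-- Since w_i acts on the symmetrizer through multiplication by `ρ`, the claim reduces to 𝐜(a)ρ +
𝐛(a) = v⁻¹. -/
theorem isLeftProd_T_symmetrizer (i : I) :
    D.IsLeftProd (D.T i) D.symmetrizer (fun u => vInvS I * D.symmetrizer u) := by
  classical
  obtain ⟨ρ, hρ⟩ := D.exists_ratio i
  obtain ⟨c, hc, -⟩ := (IsRealCoroot.simple (D := D) i).exists_expansion_cFun
  obtain ⟨b, hb, -⟩ := (IsRealCoroot.simple (D := D) i).exists_expansion_bFun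
  have h : c * ρ + b = vInvS I := by
    refine ((hc.mul (D.isExpansion_ratio hρ)).add hb).unique ?_
    convert IsExpansion.vInvR (I := I) using 1
    have h0 := one_sub_expR_ne_zero (IsRealCoroot.simple (D := D) i).ne_zero
    have h1 := one_sub_vInvR_mul_expR_ne_zero (-D.simpleCoroot i)
    rw [cFun, bFun]
    field_simp
    ring
  refine ⟨fun y => if y = D.refl i then c else b,
    fun y u => if y = D.refl i then ρ * D.symmetrizer u else D.symmetrizer u, ?_, ?_, ?_⟩
  · intro y hy
    rcases D.mem_support_T.mp hy with rfl | rfl <;> beta_reduce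
    · rw [if_pos rfl, coeff_T_refl]; exact hc
    · rw [if_neg (D.refl_ne_one i).symm, coeff_T_one]; exact hb
  · intro y hy u
    rcases D.mem_support_T.mp hy with rfl | rfl <;> beta_reduce
    · rw [if_pos rfl, refl_inv]; exact D.isTransform_symmetrizer hρ u
    · rw [if_neg (D.refl_ne_one i).symm, inv_one, one_mul]; exact D.isTransform_one _
  · intro u
    rw [sum_support_T]
    simp only [if_true, (D.refl_ne_one i).symm, if_false]
    linear_combination -D.symmetrizer u * h

theorem isLeftProd_single {w : D.weylGroup} {r : RatFun I} {f : CorootSeries I} (hr : r ≠ 0)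
    (hf : IsExpansion r f) {F G : D.weylGroup → CorootSeries I}
    (h : ∀ u, D.IsTransform w (F (w⁻¹ * u)) (G u)) :
    D.IsLeftProd (SkewMonoidAlgebra.single w r) F (fun u => f * G u) := by
  have hs : (SkewMonoidAlgebra.single w r : D.RW).support = {w} :=
    SkewMonoidAlgebra.support_single w hr
  refine ⟨fun _ => f, fun _ => G, ?_, ?_, ?_⟩
  · intro y hy
    rw [hs, Finset.mem_singleton] at hy
    rw [hy, SkewMonoidAlgebra.coeff_single, Finsupp.single_eq_same]
    exact hf
  · intro y hy
    rw [hs, Finset.mem_singleton] at hy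
    rw [hy]; exact h
  · intro u
    rw [hs, Finset.sum_singleton]

theorem isLeftProd_single_one {w : D.weylGroup} {F G : D.weylGroup → CorootSeries I}
    (h : ∀ u, D.IsTransform w (F (w⁻¹ * u)) (G u)) :
    D.IsLeftProd (SkewMonoidAlgebra.single w 1) F G := by
  simpa only [one_mul] using D.isLeftProd_single one_ne_zero IsExpansion.one h

theorem exists_isLeftProd_refl_symmetrizer (i : I) : ∃ G : D.weylGroup → CorootSeries I,
    D.IsLeftProd (SkewMonoidAlgebra.single (D.refl i) 1) D.symmetrizer G ∧
    D.IsLeftProd (SkewMonoidAlgebra.single 1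
      ((1 - vInvR I * expR (D.simpleCoroot i)) /
        (1 - vInvR I * expR (-D.simpleCoroot i)))) D.symmetrizer G := by
  obtain ⟨ρ, hρ⟩ := D.exists_ratio i
  refine ⟨fun u => ρ * D.symmetrizer u, D.isLeftProd_single_one fun u => ?_,
    D.isLeftProd_single ?_ (D.isExpansion_ratio hρ) fun u => ?_⟩
  · rw [refl_inv]; exact D.isTransform_symmetrizer hρ u
  · exact div_ne_zero (one_sub_vInvR_mul_expR_ne_zero _) (one_sub_vInvR_mul_expR_ne_zero _)
  · rw [inv_one, one_mul]; exact D.isTransform_one _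

end AffineDatum

/-! ### The product 𝔇_v -/

namespace AffineDatum

variable {I : Type*} [Fintype I] [DecidableEq I] (D : AffineDatum I)

/-- The factor `(1 - v⁻¹ e^{-γ})^{m(γ)}`. -/
def rootFactor (γ : I → ℤ) : CorootSeries I := (1 - vInvS I * expS (-γ)) ^ D.mult γ

/-- A factor with coroot `δ` only affects exponents ≤ -δ, which makes the coefficients of the
infinite product stabilize. -/
theorem supportedBelow_rootFactor_mul {A : CorootSeries I} (hA : SupportedBelow 0 A) {δ : I → ℤ}
    (hδ : 0 ≤ δ) :
    SupportedBelow 0 (D.rootFactor δ * A) ∧ SupportedBelow (-δ) (D.rootFactor δ * A - A) := by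
  rw [rootFactor]
  generalize D.mult δ = m
  have hx := supportedBelow_one_sub_vInvS_mul_expS hδ
  have hy := SupportedBelow.vInvS.mul (SupportedBelow.expS (-δ))
  rw [zero_add] at hy
  induction m with
  | zero =>
    rw [pow_zero, one_mul, sub_self]
    exact ⟨hA, fun γ h => absurd rfl h⟩
  | succ m ih =>
    constructor
    · have := hx.mul ih.1
      rw [add_zero] at this
      rwa [pow_succ', mul_assoc]
    · have h := ih.2.sub (by simpa only [add_zero] using hy.mul ih.1)
      convert h using 1
      ring

theorem supportedBelow_prod_rootFactor {A : CorootSeries I} (hA : SupportedBelow 0 A)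
    {t : Finset (I → ℤ)} (ht : ∀ δ ∈ t, 0 ≤ δ) :
    SupportedBelow 0 ((∏ δ ∈ t, D.rootFactor δ) * A) := by
  induction t using Finset.induction_on with
  | empty => simpa using hA
  | insert δ t hδ ih =>
    rw [Finset.prod_insert hδ, mul_assoc]
    exact (D.supportedBelow_rootFactor_mul (ih fun ε hε => ht ε (Finset.mem_insert_of_mem hε))
      (ht δ (Finset.mem_insert_self _ _))).1

theorem coeff_prod_rootFactor_mul {A : CorootSeries I} (hA : SupportedBelow 0 A)
    {t : Finset (I → ℤ)} {γ : I → ℤ} (ht : ∀ δ ∈ t, 0 ≤ δ ∧ ¬ δ ≤ -γ) :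
    ((∏ δ ∈ t, D.rootFactor δ) * A).coeff (OrderDual.toDual γ) =
      A.coeff (OrderDual.toDual γ) := by
  induction t using Finset.induction_on with
  | empty => simp
  | insert δ t hδ ih =>
    have ht' : ∀ ε ∈ t, 0 ≤ ε ∧ ¬ ε ≤ -γ := fun ε hε => ht ε (Finset.mem_insert_of_mem hε)
    have hδ' := ht δ (Finset.mem_insert_self _ _)
    have h1 := (D.supportedBelow_rootFactor_mul
      (D.supportedBelow_prod_rootFactor hA fun ε hε => (ht' ε hε).1) hδ'.1).2 γ
    rw [Finset.prod_insert hδ, mul_assoc, ← ih ht', ← sub_eq_zero, ← HahnSeries.coeff_sub]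
    by_contra hcon
    exact hδ'.2 (le_neg.mpr (h1 hcon))

theorem coeff_prod_rootFactor_of_subset {t t' : Finset (I → ℤ)} {γ : I → ℤ} (h : t ⊆ t')
    (h0 : ∀ δ ∈ t', 0 ≤ δ) (hγ : ∀ δ ∈ t', δ ≤ -γ → δ ∈ t) :
    (∏ δ ∈ t', D.rootFactor δ).coeff (OrderDual.toDual γ) =
      (∏ δ ∈ t, D.rootFactor δ).coeff (OrderDual.toDual γ) := by
  rw [← Finset.prod_sdiff h]
  refine D.coeff_prod_rootFactor_mul ?_ fun δ hδ => ?_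
  · simpa only [mul_one] using
      D.supportedBelow_prod_rootFactor SupportedBelow.one fun δ hδ => h0 δ (h hδ)
  · rw [Finset.mem_sdiff] at hδ
    exact ⟨h0 δ hδ.1, fun h' => hδ.2 (hγ δ hδ.1 h')⟩

open Classical in
/-- The product of the factors `(1 - v⁻¹ e^{-γ})^{m(γ)}` over all `γ ≥ 0` satisfying `Q`. -/
def rootProd (Q : (I → ℤ) → Prop) : CorootSeries I where
  coeff x := (∏ γ ∈ (Finset.Icc 0 (-OrderDual.ofDual x)).filter Q, D.rootFactor γ).coeff x
  isPWO_support' := isPWO_Iic_zero.mono fun x hx => by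
    have := D.supportedBelow_prod_rootFactor SupportedBelow.one
      (t := (Finset.Icc 0 (-OrderDual.ofDual x)).filter Q) fun δ hδ =>
        (Finset.mem_Icc.mp (Finset.mem_filter.mp hδ).1).1
    rw [mul_one] at this
    exact this (OrderDual.ofDual x) hx

theorem Dv_eq_rootProd : D.Dv = D.rootProd D.IsPosCoroot := rfl

variable {Q : (I → ℤ) → Prop}

-- Any finite set of admissible coroots containing all those ≤ -γ computes the coefficient at e^γ.
-- This freedom permits comparing different truncations.
open Classical in
theorem coeff_rootProd {t : Finset (I → ℤ)} {γ : I → ℤ} (h0 : ∀ δ ∈ t, 0 ≤ δ ∧ Q δ)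
    (hγ : ∀ δ, 0 ≤ δ → Q δ → δ ≤ -γ → δ ∈ t) :
    (D.rootProd Q).coeff (OrderDual.toDual γ) =
      (∏ δ ∈ t, D.rootFactor δ).coeff (OrderDual.toDual γ) := by
  refine (D.coeff_prod_rootFactor_of_subset ?_ (fun δ hδ => (h0 δ hδ).1) ?_).symm
  · intro δ hδ
    rw [Finset.mem_filter, Finset.mem_Icc] at hδ
    exact hγ δ hδ.1.1 hδ.2 hδ.1.2
  · intro δ hδ h
    rw [Finset.mem_filter, Finset.mem_Icc]
    exact ⟨⟨(h0 δ hδ).1, h⟩, (h0 δ hδ).2⟩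

theorem supportedBelow_rootProd : SupportedBelow 0 (D.rootProd Q) := by
  classical
  intro γ h
  have := D.supportedBelow_prod_rootFactor SupportedBelow.one
    (t := (Finset.Icc 0 (-γ)).filter Q) fun δ hδ =>
      (Finset.mem_Icc.mp (Finset.mem_filter.mp hδ).1).1
  rw [mul_one] at this
  refine this γ ?_
  rwa [← D.coeff_rootProd]
  · intro δ hδ
    rw [Finset.mem_filter, Finset.mem_Icc] at hδ
    exact ⟨hδ.1.1, hδ.2⟩
  · intro δ h1 h2 h3
    rw [Finset.mem_filter, Finset.mem_Icc]
    exact ⟨⟨h1, h3⟩, h2⟩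

theorem coeff_zero_rootProd (h : ¬ Q 0) : (D.rootProd Q).coeff 0 = 1 := by
  have := D.coeff_rootProd (Q := Q) (t := ∅) (γ := 0) (by simp) (by
    intro δ h1 h2 h3
    rw [neg_zero] at h3
    rw [le_antisymm h3 h1] at h2
    exact absurd h2 h)
  rw [Finset.prod_empty, HahnSeries.coeff_one,
    if_pos (show OrderDual.toDual (0 : I → ℤ) = 0 from rfl)] at this
  exact this

theorem rootProd_eq_rootFactor_mul {Q' : (I → ℤ) → Prop} {α : I → ℤ} (hα : 0 ≤ α) (hα' : ¬ Q' α)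
    (h : ∀ δ, Q δ ↔ δ = α ∨ Q' δ) : D.rootProd Q = D.rootFactor α * D.rootProd Q' := by
  classical
  ext x : 2
  obtain ⟨γ, rfl⟩ := OrderDual.toDual.surjective x
  set t := (Finset.Icc 0 (-γ)).filter Q' with ht
  have hmem : ∀ δ, δ ∈ t ↔ (0 ≤ δ ∧ δ ≤ -γ) ∧ Q' δ := fun δ => by
    rw [ht, Finset.mem_filter, Finset.mem_Icc]
  have h1 : (D.rootProd Q).coeff (OrderDual.toDual γ) =
      (∏ δ ∈ insert α t, D.rootFactor δ).coeff (OrderDual.toDual γ) := by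
    refine D.coeff_rootProd ?_ ?_
    · intro δ hδ
      rw [Finset.mem_insert, hmem] at hδ
      rcases hδ with rfl | hδ
      · exact ⟨hα, (h _).mpr (Or.inl rfl)⟩
      · exact ⟨hδ.1.1, (h _).mpr (Or.inr hδ.2)⟩
    · intro δ h1 h2 h3
      rw [Finset.mem_insert, hmem]
      exact ((h δ).mp h2).imp_right fun h4 => ⟨⟨h1, h3⟩, h4⟩
  rw [h1, Finset.prod_insert (by rw [hmem]; exact fun h => hα' h.2), ← sub_eq_zero,
    ← HahnSeries.coeff_sub, ← mul_sub]
  by_contra hcon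
  obtain ⟨μ, ν, h2, h3, h4⟩ := exists_coeff_ne_zero_of_mul hcon
  have h5 := (D.supportedBelow_rootFactor_mul SupportedBelow.one hα).1
  rw [mul_one] at h5
  -- A discrepancy at `γ` would come from one at some ν ≥ γ, where the truncation taken for `γ` is
  -- already sufficient.
  have h6 : γ ≤ ν := by
    rw [← h4]
    exact add_le_of_nonpos_left (h5 μ h2)
  apply h3
  rw [HahnSeries.coeff_sub, sub_eq_zero]
  symm
  refine D.coeff_rootProd (fun δ hδ => ?_) fun δ h7 h8 h9 => ?_
  · rw [hmem] at hδ
    exact ⟨hδ.1.1, hδ.2⟩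
  · rw [hmem]
    exact ⟨⟨h7, h9.trans (neg_le_neg h6)⟩, h8⟩

theorem mult_apply (w : D.weylGroup) (γ : I → ℤ) : D.mult (w.1 γ) = D.mult γ := by
  have : D.IsRealCoroot (w.1 γ) ↔ D.IsRealCoroot γ :=
    ⟨fun h => by simpa using h.apply w⁻¹, fun h => h.apply w⟩
  rw [mult, mult]
  by_cases h : D.IsRealCoroot γ
  · rw [if_pos (this.mpr h), if_pos h]
  · rw [if_neg (fun h' => h (this.mp h')), if_neg h]

theorem permuted_rootFactor (w : D.weylGroup) (γ : I → ℤ) :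
    Permuted w (D.rootFactor γ) (D.rootFactor (w.1 γ)) := by
  rw [rootFactor, rootFactor, mult_apply]
  have h := Permuted.toSeries w (1 - vInvA I * expA (-γ))
  rw [smul_sub, smul_one, smul_mul', smul_vInvA, smul_expA, map_neg,
    toSeries_one_sub_vInvA_mul_expA, toSeries_one_sub_vInvA_mul_expA] at h
  generalize D.mult γ = m
  induction m with
  | zero => rw [pow_zero, pow_zero]; exact Permuted.one
  | succ m ih => rw [pow_succ, pow_succ]; exact ih.mul h

theorem permuted_prod_rootFactor (w : D.weylGroup) (t : Finset (I → ℤ)) :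
    Permuted w (∏ δ ∈ t, D.rootFactor δ) (∏ δ ∈ t, D.rootFactor (w.1 δ)) := by
  induction t using Finset.induction_on with
  | empty => rw [Finset.prod_empty, Finset.prod_empty]; exact Permuted.one
  | insert δ t hδ ih =>
    rw [Finset.prod_insert hδ, Finset.prod_insert hδ]
    exact (D.permuted_rootFactor w δ).mul ih

theorem permuted_rootProd {w : D.weylGroup} (h0 : ∀ δ, Q δ → 0 ≤ δ) (hw : ∀ δ, Q (w.1 δ) ↔ Q δ) :
    Permuted w (D.rootProd Q) (D.rootProd Q) := by
  classical
  intro γ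
  -- Chosen so that `t` is large enough for the coefficient at `γ` and its image under `w` for the
  -- coefficient at w γ.
  let t : Finset (I → ℤ) := (Finset.Icc 0 (-γ)).filter Q ∪
    ((Finset.Icc 0 (-(w.1 γ))).filter Q).image w⁻¹.1
  have ht : ∀ δ ∈ t, Q δ := by
    intro δ hδ
    rcases Finset.mem_union.mp hδ with hδ | hδ
    · exact (Finset.mem_filter.mp hδ).2
    · obtain ⟨ε, hε, rfl⟩ := Finset.mem_image.mp hδ
      rw [← hw, apply_inv_apply]
      exact (Finset.mem_filter.mp hε).2
  have h1 : (D.rootProd Q).coeff (OrderDual.toDual γ) =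
      (∏ δ ∈ t, D.rootFactor δ).coeff (OrderDual.toDual γ) := by
    refine D.coeff_rootProd (fun δ hδ => ⟨h0 δ (ht δ hδ), ht δ hδ⟩) fun δ h2 h3 h4 => ?_
    exact Finset.mem_union_left _ (Finset.mem_filter.mpr ⟨Finset.mem_Icc.mpr ⟨h2, h4⟩, h3⟩)
  have h2 : (D.rootProd Q).coeff (OrderDual.toDual (w.1 γ)) =
      (∏ δ ∈ t.image w.1, D.rootFactor δ).coeff (OrderDual.toDual (w.1 γ)) := by
    refine D.coeff_rootProd (fun δ hδ => ?_) fun δ h2 h3 h4 => ?_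
    · obtain ⟨ε, hε, rfl⟩ := Finset.mem_image.mp hδ
      have := (hw ε).mpr (ht ε hε)
      exact ⟨h0 _ this, this⟩
    · refine Finset.mem_image.mpr ⟨w⁻¹.1 δ, ?_, D.apply_inv_apply w δ⟩
      exact Finset.mem_union_right _ (Finset.mem_image_of_mem _
        (Finset.mem_filter.mpr ⟨Finset.mem_Icc.mpr ⟨h2, h4⟩, h3⟩))
  rw [h1, h2, Finset.prod_image (fun x _ y _ h => w.1.injective h)]
  exact D.permuted_prod_rootFactor w t γ

theorem c_nonneg : 0 ≤ D.c := fun i => (D.c_pos i).le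

variable {D}

theorem IsPosCoroot.nonneg {γ : I → ℤ} (h : D.IsPosCoroot γ) : 0 ≤ γ := by
  rcases h with h | ⟨n, -, rfl⟩
  · exact h.2
  · exact nsmul_nonneg D.c_nonneg n

theorem not_isPosCoroot_zero : ¬ D.IsPosCoroot 0 := by
  rintro (h | ⟨n, hn, h⟩)
  · exact h.1.ne_zero rfl
  · obtain ⟨i⟩ := D.nonempty
    have h1 := congrFun h i
    have h2 := D.c_pos i
    simp only [Pi.zero_apply, Pi.smul_apply, nsmul_eq_mul] at h1
    have : (0 : ℤ) < n * D.c i := by positivity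
    omega

theorem IsPosCoroot.refl_apply {γ : I → ℤ} {i : I} (h : D.IsPosCoroot γ)
    (h' : γ ≠ D.simpleCoroot i) :
    D.IsPosCoroot ((D.refl i).1 γ) ∧ (D.refl i).1 γ ≠ D.simpleCoroot i := by
  have hpos : D.IsPosCoroot ((D.refl i).1 γ) := by
    rcases h with h | ⟨n, hn, rfl⟩
    · exact Or.inl ⟨h.1.apply _, h.1.refl_nonneg h.2 h'⟩
    · exact Or.inr ⟨n, hn, by rw [map_nsmul, apply_c]⟩
  refine ⟨hpos, fun h1 => ?_⟩
  have h2 : γ = -D.simpleCoroot i := by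
    rw [← D.refl_refl_apply i γ, h1, refl_simpleCoroot]
  have h3 := h.nonneg
  rw [h2] at h3
  exact (IsRealCoroot.simple (D := D) i).ne_zero
    (le_antisymm (by simpa using h3) (D.simpleCoroot_nonneg i))

variable (D)

/-- The product `𝔇_v` without the factor of the simple coroot `a_i^∨`. -/
def DvOmit (i : I) : CorootSeries I :=
  D.rootProd fun δ => D.IsPosCoroot δ ∧ δ ≠ D.simpleCoroot i

theorem rootFactor_simpleCoroot (i : I) :
    D.rootFactor (D.simpleCoroot i) = 1 - vInvS I * expS (-D.simpleCoroot i) := by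
  rw [rootFactor, mult, if_pos (IsRealCoroot.simple i), pow_one]

theorem Dv_eq_mul_DvOmit (i : I) :
    D.Dv = (1 - vInvS I * expS (-D.simpleCoroot i)) * D.DvOmit i := by
  rw [Dv_eq_rootProd, ← rootFactor_simpleCoroot]
  refine D.rootProd_eq_rootFactor_mul (D.simpleCoroot_nonneg i) (fun h => h.2 rfl) fun δ => ?_
  by_cases h : δ = D.simpleCoroot i
  · subst h
    exact iff_of_true (Or.inl ⟨IsRealCoroot.simple i, D.simpleCoroot_nonneg i⟩) (Or.inl rfl)
  · simp [h]

theorem permuted_DvOmit (i : I) : Permuted (D.refl i) (D.DvOmit i) (D.DvOmit i) := by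
  refine D.permuted_rootProd (fun δ h => h.1.nonneg) fun δ =>
    ⟨fun h => ?_, fun h => h.1.refl_apply h.2⟩
  have := h.1.refl_apply h.2
  rwa [refl_refl_apply] at this

theorem exists_inverse_Dv : ∃ E, SupportedBelow 0 E ∧ D.Dv * E = 1 := by
  rw [Dv_eq_rootProd]
  exact D.supportedBelow_rootProd.exists_inverse (D.coeff_zero_rootProd not_isPosCoroot_zero)

theorem isUnit_Dv : IsUnit D.Dv := by
  obtain ⟨E, -, hE⟩ := D.exists_inverse_Dv
  exact .of_mul_eq_one E hE

theorem Dv_mul_inverse : D.Dv * Ring.inverse D.Dv = 1 := Ring.mul_inverse_cancel _ D.isUnit_Dv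

theorem inverse_Dv_supportedBelow : SupportedBelow 0 (Ring.inverse D.Dv) := by
  obtain ⟨E, hE, h⟩ := D.exists_inverse_Dv
  have : Ring.inverse D.Dv = E := by
    linear_combination E * D.Dv_mul_inverse - Ring.inverse D.Dv * h
  rwa [this]

/-- The series is the inverse of `DvOmit`, which is w_i-invariant. -/
theorem permuted_mul_inverse_Dv (i : I) :
    Permuted (D.refl i)
      ((1 - vInvS I * expS (-D.simpleCoroot i)) * Ring.inverse D.Dv)
      ((1 - vInvS I * expS (-D.simpleCoroot i)) * Ring.inverse D.Dv) := by
  have h : D.DvOmit i * ((1 - vInvS I * expS (-D.simpleCoroot i)) * Ring.inverse D.Dv) = 1 := by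
    linear_combination D.Dv_mul_inverse - Ring.inverse D.Dv * D.Dv_eq_mul_DvOmit i
  have h1 : SupportedBelow 0 (D.DvOmit i) := D.supportedBelow_rootProd
  have h2 := (supportedBelow_one_sub_vInvS_mul_expS (D.simpleCoroot_nonneg i)).mul
    D.inverse_Dv_supportedBelow
  rw [add_zero] at h2
  exact (D.permuted_DvOmit i).inverse h1 h1
    (D.coeff_zero_rootProd fun h => not_isPosCoroot_zero h.1) h2 h h

/-! ### Invariance of the normalized symmetrizer -/

variable {D}

theorem IsTransform.trans {w w' : D.weylGroup} {f g h : CorootSeries I} (h1 : D.IsTransform w f g)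
    (h2 : D.IsTransform w' g h) : D.IsTransform (w' * w) f h := by
  obtain ⟨d, hd, hfg⟩ := h1
  obtain ⟨d', hd', hgh⟩ := h2
  have hfg' : Permuted w _ _ := hfg
  have hgh' : Permuted w' _ _ := hgh
  -- The second denominator is pulled back by `w`, so that it becomes `d'` after the first
  -- transformation.
  refine ⟨d * w⁻¹ • d', mul_ne_zero hd ((smul_ne_zero_iff_ne _).mpr hd'), ?_⟩
  have e1 := (Permuted.toSeries w (w⁻¹ • d')).mul hfg'
  have e2 := (Permuted.toSeries w' (w • d)).mul hgh'
  rw [smul_inv_smul] at e1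
  have e3 : toSeries I (w • d) * (toSeries I d' * g) = toSeries I d' * (toSeries I (w • d) * g) := by
    ring
  rw [e3] at e2
  have e4 := e1.trans e2
  have e5 : toSeries I (w⁻¹ • d') * (toSeries I d * f) = toSeries I (d * w⁻¹ • d') * f := by
    rw [map_mul]; ring
  have e6 : toSeries I (w' • w • d) * (toSeries I (w' • d') * h) =
      toSeries I ((w' * w) • (d * w⁻¹ • d')) * h := by
    rw [smul_mul', mul_smul, mul_smul, smul_inv_smul, map_mul]; ring
  rw [e5, e6] at e4
  exact e4

variable (D)

/-- Multiplying `permuted_symmetrizer` by the invariant series (1 - v⁻¹e^{-a})𝔇_v⁻¹ supplies the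
factor 1 - v⁻¹e^{-a} that was missing, so the ratio disappears. -/
theorem isTransform_refl_inverse_Dv_mul_symmetrizer (i : I) (u : D.weylGroup) :
    D.IsTransform (D.refl i) (Ring.inverse D.Dv * D.symmetrizer (D.refl i * u))
      (Ring.inverse D.Dv * D.symmetrizer u) := by
  have h := (D.permuted_mul_inverse_Dv i).mul (D.permuted_symmetrizer i u)
  refine ⟨(1 - expA (D.simpleCoroot i)) * (1 - vInvA I * expA (D.simpleCoroot i)) *
    (1 - vInvA I * expA (-D.simpleCoroot i)),
    mul_ne_zero (mul_ne_zero (one_sub_expA_ne_zero (IsRealCoroot.simple (D := D) i).ne_zero)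
      (one_sub_vInvA_mul_expA_ne_zero _)) (one_sub_vInvA_mul_expA_ne_zero _), ?_⟩
  have hs : D.refl i • (1 - vInvA I * expA (-D.simpleCoroot i)) =
      1 - vInvA I * expA (D.simpleCoroot i) := by
    rw [smul_sub, smul_one, smul_mul', smul_vInvA, smul_expA, map_neg, refl_simpleCoroot, neg_neg]
  change Permuted (D.refl i) _ _
  rw [smul_mul', smul_denominator, hs]
  simp only [map_mul, toSeries_one_sub_vInvA_mul_expA] at h ⊢
  convert h using 1 <;> ring

theorem isTransform_inverse_Dv_mul_symmetrizer (w u : D.weylGroup) :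
    D.IsTransform w (Ring.inverse D.Dv * D.symmetrizer (w⁻¹ * u))
      (Ring.inverse D.Dv * D.symmetrizer u) := by
  induction w using D.weyl_induction generalizing u with
  | one =>
    rw [inv_one, one_mul]
    exact D.isTransform_one _
  | step w i ih =>
    have h := D.isTransform_refl_inverse_Dv_mul_symmetrizer i (w⁻¹ * u)
    rw [← mul_assoc, ← D.refl_inv i, ← mul_inv_rev, D.refl_inv i] at h
    exact h.trans (ih u)

end AffineDatum

end

theorem lemma5p6 {I : Type*} [Fintype I] [DecidableEq I] (D : AffineDatum I) :
    (∃! P : D.weylGroup → CorootSeries I, D.IsSymmetrizer P) ∧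
    IsUnit D.Dv ∧
    ∀ P : D.weylGroup → CorootSeries I, D.IsSymmetrizer P →
      (∀ u, P u ∈ QFin I) ∧
      (∀ i : I, D.IsLeftProd (D.T i) P (fun u => vInvS I * P u)) ∧
      (∀ i : I, D.IsRightProd P (D.T i) (fun u => vInvS I * P u)) ∧
      (∀ i : I, ∃ G : D.weylGroup → CorootSeries I,
        D.IsLeftProd (SkewMonoidAlgebra.single (D.refl i) 1) P G ∧
        D.IsLeftProd (SkewMonoidAlgebra.single 1
          ((1 - vInvR I * expR (D.simpleCoroot i)) /
            (1 - vInvR I * expR (-D.simpleCoroot i)))) P G) ∧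
      (∀ u, Ring.inverse D.Dv * P u ∈ QFin I) ∧
      (∀ w : D.weylGroup,
        D.IsLeftProd (SkewMonoidAlgebra.single w 1)
          (fun u => Ring.inverse D.Dv * P u) (fun u => Ring.inverse D.Dv * P u)) := by
  refine ⟨⟨D.symmetrizer, (D.isSymmetrizer_iff _).mpr rfl, fun P hP => (D.isSymmetrizer_iff P).mp hP⟩,
    D.isUnit_Dv, fun P hP => ?_⟩
  obtain rfl := (D.isSymmetrizer_iff P).mp hP
  refine ⟨fun u => D.symmetrizer_supportedBelow u, D.isLeftProd_T_symmetrizer,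
    D.isRightProd_symmetrizer, D.exists_isLeftProd_refl_symmetrizer, fun u => ?_, fun w => ?_⟩
  · have := D.inverse_Dv_supportedBelow.mul (D.symmetrizer_supportedBelow u)
    rwa [add_zero] at this
  · exact D.isLeftProd_single_one fun u => D.isTransform_inverse_Dv_mul_symmetrizer w u
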